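/- For two words $u,v$ over an alphabet $\Sigma$, let $u\|v\subseteq\Sigma^*$ denote the set of all words obtained by interleaving the letters of $u$ and $v$; that is, $\varepsilon\|v=\{v\}$, $u\|\varepsilon=\{u\}$, and $(a\cdot u)\|(b\cdot v)=a\cdot(u\|(b\cdot v))\cup b\cdot((a\cdot u)\|v)$ for $a,b\in\Sigma$. The shuffling problem is the following decision problem: given two finite alphabets $\Sigma_u,\Sigma_v$ and a regular language $L$ over the disjoint union $\Sigma_u\uplus\Sigma_v$, presented by a (nondeterministic) finite automaton, decide whether there exist words $u\in\Sigma_u^*$ and $v\in\Sigma_v^*$ such that $(u\|v)\cap L=\emptyset$. The shuffling problem is undecidable, i.e. no algorithm solves it on all instances. -/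

import Mathlib

/-- The set of all interleavings of two words over a common alphabet. -/
def shuffle {α : Type*} : List α → List α → Set (List α)
  | [], v => {v}
  | a :: u, [] => {a :: u}
  | a :: u, b :: v =>
      (fun w => a :: w) '' shuffle u (b :: v) ∪ (fun w => b :: w) '' shuffle (a :: u) v
termination_by u v => u.length + v.length

/-- A finite description of a (nondeterministic) finite automaton whose letters are tagged
`Sum.inl i` (the `i`-th letter of the first alphabet) or `Sum.inr j` (the `j`-th letter of the
second alphabet).  The states are `0, …, states - 1`; `trans` lists the triples
(source, letter, target), `start` the initial states and `accept` the final states. -/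
structure AutomatonCode where
  states : ℕ
  trans : List (ℕ × (ℕ ⊕ ℕ) × ℕ)
  start : List ℕ
  accept : List ℕ

/-- The components of an automaton description, as a tuple. -/
def AutomatonCode.equivTuple :
    AutomatonCode ≃ ℕ × List (ℕ × (ℕ ⊕ ℕ) × ℕ) × List ℕ × List ℕ where
  toFun A := (A.states, A.trans, A.start, A.accept)
  invFun t := ⟨t.1, t.2.1, t.2.2.1, t.2.2.2⟩
  left_inv _ := rfl
  right_inv _ := rfl

instance AutomatonCode.instPrimcodable : Primcodable AutomatonCode :=
  Primcodable.ofEquiv _ AutomatonCode.equivTuple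

/-- The automaton described by a code, over the disjoint union of an alphabet with `m` letters
and an alphabet with `n` letters. -/
def AutomatonCode.toNFA (A : AutomatonCode) (m n : ℕ) : NFA (Fin m ⊕ Fin n) (Fin A.states) where
  step s a := {t | ((s : ℕ), Sum.map Fin.val Fin.val a, (t : ℕ)) ∈ A.trans}
  start := {s | (s : ℕ) ∈ A.start}
  accept := {s | (s : ℕ) ∈ A.accept}

/-- The regular language over the disjoint union of an `m`-letter and an `n`-letter alphabet that
is presented by a code. -/
def AutomatonCode.language (A : AutomatonCode) (m n : ℕ) : Language (Fin m ⊕ Fin n) :=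
  (A.toNFA m n).accepts

/-- The languages presented by codes are exactly the regular languages. -/
theorem AutomatonCode.isRegular_iff_exists_language {m n : ℕ} (L : Language (Fin m ⊕ Fin n)) :
    L.IsRegular ↔ ∃ A : AutomatonCode, A.language m n = L := by
  classical
  constructor
  · rintro ⟨σ, _, M, rfl⟩
    let e := Fintype.equivFin σ
    let N : DFA (Fin m ⊕ Fin n) (Fin (Fintype.card σ)) := DFA.reindex e M
    refine ⟨⟨Fintype.card σ,
      (Finset.univ : Finset (Fin (Fintype.card σ) × (Fin m ⊕ Fin n))).toList.map
        (fun p => ((p.1 : ℕ), Sum.map Fin.val Fin.val p.2, (N.step p.1 p.2 : ℕ))),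
      [(N.start : ℕ)],
      (Finset.univ.filter (fun s => s ∈ N.accept)).toList.map Fin.val⟩, ?_⟩
    rw [← DFA.accepts_reindex M e, ← DFA.toNFA_correct]
    unfold AutomatonCode.language
    congr 1
    have inj : Function.Injective
        (Sum.map Fin.val Fin.val : Fin m ⊕ Fin n → ℕ ⊕ ℕ) :=
      Sum.map_injective.2 ⟨Fin.val_injective, Fin.val_injective⟩
    refine NFA.mk.injEq .. |>.mpr ⟨?_, ?_, ?_⟩
    · funext s a
      ext t
      simp only [List.mem_map, Finset.mem_toList, Finset.mem_univ, true_and, Prod.mk.injEq,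
        Set.mem_ofPred_eq, Prod.exists]
      constructor
      · rintro ⟨s', a', h1, h2, h3⟩
        obtain rfl := Fin.val_injective h1
        obtain rfl := inj h2
        exact (Fin.val_injective h3).symm
      · intro h
        exact ⟨s, a, rfl, rfl, congrArg Fin.val (Eq.symm h)⟩
    · ext t
      simp [N, Fin.ext_iff]
    · ext t
      simp only [List.mem_map, Finset.mem_toList, Finset.mem_filter, Finset.mem_univ, true_and,
        Set.mem_ofPred_eq]
      constructor
      · rintro ⟨s, hs, h⟩
        obtain rfl := Fin.val_injective h
        exact hs
      · intro h
        exact ⟨t, h, rfl⟩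
  · rintro ⟨A, rfl⟩
    rw [AutomatonCode.language, ← NFA.toDFA_correct]
    exact ⟨_, inferInstance, _, rfl⟩

/-- The shuffling problem.  An instance `(m, n, A)` consists of the alphabets
`Σᵤ = {0, …, m - 1}` and `Σᵥ = {0, …, n - 1}`, made disjoint by tagging, and of an automaton for
a regular language `L` over `Σᵤ ⊎ Σᵥ`; the question is whether there are words `u` over `Σᵤ` and
`v` over `Σᵥ` none of whose interleavings belongs to `L`. -/
def ShufflingProblem (I : ℕ × ℕ × AutomatonCode) : Prop :=
  ∃ (u : List (Fin I.1)) (v : List (Fin I.2.1)),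
    shuffle (u.map Sum.inl) (v.map Sum.inr) ∩ {w | w ∈ I.2.2.language I.1 I.2.1} = ∅

/-! Halting is reduced to the shuffling problem. A finite automaton cannot check that two long words
agree, but the choice of interleaving lets it refute agreement: some interleaving keeps the images
of `u` under `f` and of `v` under `g` in step up to their first discrepancy, where finite memory
suffices to see it. So a regular language `mismatch f g` meets the shuffle of `u` and `v` exactly
when these images differ (`exists_mem_mismatch_iff`). For a union `L` of such languages,
disjointness from `L` is a conjunction of equations. Adding the equation `u = v` and the complement
of a regular language `R` on the first projection, one can express: `u ∈ R`, the input and output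
tracks of `u` agree, and so do its two comparison tracks.

These equations simulate computation. The output track runs one round ahead of the input track, so
their equality makes each round read what the previous one wrote. A round edits a word encoding a
stack of lists of numbers in unary; the nonregular demand that two blocks within a round be equal is
left to the comparison tracks. Composition, union and iteration of relations correspond to product,
sum and star of trace languages, which suffices for every constructor of `Turing.ToPartrec.Code`
(`Stack.Realizable.onTop_eval`).

The trace language depends on the program alone. For one universal program, an automaton for `L` is
therefore fixed once, by mere existence. The input `n` enters as the number of letters `digit` in
`u`, enforced by an explicit counter (`AutomatonCode.addCount`), the only part that has to be
computed from `n`. -/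

open scoped Computability

/-! ### Closure properties of regular languages. -/

namespace Language

variable {α : Type*}

/-- A language recognized by a deterministic automaton with finitely many states is regular. -/
theorem isRegular_of_finite {σ : Type*} [Finite σ] (M : DFA α σ) : IsRegular M.accepts := by
  have := Fintype.ofFinite σ
  exact isRegular_iff.2 ⟨σ, this, M, rfl⟩

-- Subset construction: besides the state of `M`, the automaton remembers the states that `N` may
-- have reached after each split point at which the prefix was accepted by `M`.
open Classical in
theorem IsRegular.mul {L K : Language α} (hL : L.IsRegular) (hK : K.IsRegular) :
    (L * K).IsRegular := by
  obtain ⟨σ, _, M, rfl⟩ := hL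
  obtain ⟨τ, _, N, rfl⟩ := hK
  let D : DFA α (σ × Set τ) :=
    { step := fun p a => (M.step p.1 a,
        {t | (∃ s ∈ p.2, N.step s a = t) ∨ M.step p.1 a ∈ M.accept ∧ t = N.start})
      start := (M.start, {t | M.start ∈ M.accept ∧ t = N.start})
      accept := {p | ∃ t ∈ p.2, t ∈ N.accept} }
  have key : ∀ w, (D.eval w).1 = M.eval w ∧
      ∀ t, t ∈ (D.eval w).2 ↔ ∃ x y, x ++ y = w ∧ x ∈ M.accepts ∧ N.eval y = t := by
    intro w
    induction w using List.reverseRecOn with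
    | nil =>
      refine ⟨rfl, fun t => ?_⟩
      simp [D, DFA.mem_accepts, eq_comm]
    | append_singleton w a ih =>
      refine ⟨by simp [D, ← ih.1], fun t => ?_⟩
      rw [DFA.eval_append_singleton]
      change ((∃ s ∈ (D.eval w).2, N.step s a = t) ∨
        M.step (D.eval w).1 a ∈ M.accept ∧ t = N.start) ↔ _
      rw [ih.1, ← DFA.eval_append_singleton]
      constructor
      · rintro (⟨s, hs, rfl⟩ | ⟨h, rfl⟩)
        · obtain ⟨x, y, rfl, hx, rfl⟩ := (ih.2 s).1 hs
          exact ⟨x, y ++ [a], by simp, hx, by simp⟩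
        · exact ⟨w ++ [a], [], by simp, h, rfl⟩
      · rintro ⟨x, y, hxy, hx, rfl⟩
        rcases List.eq_nil_or_concat' y with rfl | ⟨y, b, rfl⟩
        · right
          rw [List.append_nil] at hxy
          subst hxy
          exact ⟨hx, rfl⟩
        · left
          rw [← List.append_assoc] at hxy
          obtain ⟨rfl, h⟩ := List.append_inj' hxy rfl
          obtain rfl : b = a := by simpa using h
          exact ⟨_, (ih.2 _).2 ⟨x, y, rfl, hx, rfl⟩, by simp⟩
  convert! isRegular_of_finite D using 1
  ext w
  rw [mem_mul]
  constructor
  · rintro ⟨x, hx, y, hy, rfl⟩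
    exact ⟨_, ((key _).2 _).2 ⟨x, y, rfl, hx, rfl⟩, hy⟩
  · rintro ⟨t, ht, h⟩
    obtain ⟨x, y, rfl, hx, rfl⟩ := ((key _).2 _).1 ht
    exact ⟨x, hx, y, h, rfl⟩

theorem append_mem_kstar {L : Language α} {x y : List α} (hx : x ∈ L∗) (hy : y ∈ L) :
    x ++ y ∈ L∗ := by
  rw [← one_add_kstar_mul_self_eq_kstar]
  exact Or.inr (append_mem_mul hx hy)

theorem cons_mem_kstar {L : Language α} {x y : List α} (hx : x ∈ L) (hy : y ∈ L∗) :
    x ++ y ∈ L∗ := by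
  rw [← one_add_self_mul_kstar_eq_kstar]
  exact Or.inr (append_mem_mul hx hy)

/-- Induction on the number of factors of a word in the Kleene star of a language. -/
theorem kstar_induction {L : Language α} {p : List α → Prop} (nil : p [])
    (append : ∀ x ∈ L, ∀ y ∈ L∗, p y → p (x ++ y)) {w : List α} (hw : w ∈ L∗) : p w := by
  obtain ⟨l, rfl, hl⟩ := mem_kstar.1 hw
  clear hw
  induction l with
  | nil => exact nil
  | cons x l ih =>
    have hl' := fun y hy => hl y (List.mem_cons_of_mem _ hy)
    exact append x (hl x List.mem_cons_self) _ (join_mem_kstar hl') (ih hl')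

/-- Discarding empty factors, the last letter lies in a last nonempty factor, which is cut off. This
is the recursion that the automaton for the star follows. -/
theorem concat_mem_kstar_iff {L : Language α} {w : List α} {a : α} :
    w ++ [a] ∈ L∗ ↔ ∃ x ∈ L∗, ∃ y, x ++ y = w ∧ y ++ [a] ∈ L := by
  constructor
  · intro h
    obtain ⟨l, hl, hL⟩ := (kstar_def_nonempty L ▸ h : w ++ [a] ∈ {x | _})
    rcases List.eq_nil_or_concat' l with rfl | ⟨l, z, rfl⟩
    · simp at hl
    · obtain ⟨hz, hne⟩ := hL z (by simp)
      rcases List.eq_nil_or_concat' z with rfl | ⟨y, b, rfl⟩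
      · exact absurd rfl hne
      · simp only [List.flatten_append, List.flatten_cons, List.flatten_nil, List.append_nil,
          ← List.append_assoc] at hl
        obtain ⟨rfl, hab⟩ := List.append_inj' hl rfl
        obtain rfl : a = b := by simpa using hab
        exact ⟨_, join_mem_kstar fun y hy => (hL y (by simp [hy])).1, y, rfl, hz⟩
  · rintro ⟨x, hx, y, rfl, hy⟩
    rw [List.append_assoc]
    exact append_mem_kstar hx hy

open Classical in
theorem IsRegular.kstar {L : Language α} (hL : L.IsRegular) : (L∗).IsRegular := by
  obtain ⟨σ, _, M, rfl⟩ := hL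
  let acc (S : Set σ) (a : α) : Prop := ∃ s ∈ S, M.step s a ∈ M.accept
  -- The set holds the states of `M` reached from all possible starts of the current factor. The
  -- separate bit records membership in the star, so that the empty word is accepted even if
  -- `M.start` is not accepting.
  let D : DFA α (Set σ × Prop) :=
    { step := fun p a => ({t | (∃ s ∈ p.1, M.step s a = t) ∨ acc p.1 a ∧ t = M.start}, acc p.1 a)
      start := ({M.start}, True)
      accept := {p | p.2} }
  have key : ∀ w, ((D.eval w).2 ↔ w ∈ M.accepts∗) ∧
      ∀ t, t ∈ (D.eval w).1 ↔ ∃ x ∈ M.accepts∗, ∃ y, x ++ y = w ∧ M.eval y = t := by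
    intro w
    induction w using List.reverseRecOn with
    | nil =>
      refine ⟨by simp [D, nil_mem_kstar], fun t => ?_⟩
      simp [D, nil_mem_kstar, eq_comm]
    | append_singleton w a ih =>
      have hacc : acc (D.eval w).1 a ↔ w ++ [a] ∈ M.accepts∗ := by
        rw [concat_mem_kstar_iff]
        constructor
        · rintro ⟨s, hs, h⟩
          obtain ⟨x, hx, y, rfl, rfl⟩ := (ih.2 s).1 hs
          exact ⟨x, hx, y, rfl, by simpa [DFA.mem_accepts] using h⟩
        · rintro ⟨x, hx, y, rfl, hy⟩
          exact ⟨M.eval y, (ih.2 _).2 ⟨x, hx, y, rfl, rfl⟩, by simpa [DFA.mem_accepts] using hy⟩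
      rw [DFA.eval_append_singleton]
      refine ⟨hacc, fun t => ?_⟩
      change ((∃ s ∈ (D.eval w).1, M.step s a = t) ∨ acc (D.eval w).1 a ∧ t = M.start) ↔ _
      rw [hacc]
      constructor
      · rintro (⟨s, hs, rfl⟩ | ⟨h, rfl⟩)
        · obtain ⟨x, hx, y, rfl, rfl⟩ := (ih.2 s).1 hs
          exact ⟨x, hx, y ++ [a], by simp, by simp⟩
        · exact ⟨w ++ [a], h, [], by simp, rfl⟩
      · rintro ⟨x, hx, y, hxy, rfl⟩
        rcases List.eq_nil_or_concat' y with rfl | ⟨y, b, rfl⟩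
        · right
          rw [List.append_nil] at hxy
          subst hxy
          exact ⟨hx, rfl⟩
        · left
          rw [← List.append_assoc] at hxy
          obtain ⟨rfl, h⟩ := List.append_inj' hxy rfl
          obtain rfl : b = a := by simpa using h
          exact ⟨_, (ih.2 _).2 ⟨x, hx, y, rfl, rfl⟩, by simp⟩
  convert! isRegular_of_finite D using 1
  ext w
  exact (key w).1.symm

/-- The words all of whose letters satisfy a predicate. -/
def lettersIn (p : α → Prop) : Language α := {w | ∀ a ∈ w, p a}

theorem mem_lettersIn {p : α → Prop} {w : List α} : w ∈ lettersIn p ↔ ∀ a ∈ w, p a := Iff.rfl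

theorem isRegular_lettersIn (p : α → Prop) : (lettersIn p).IsRegular := by
  let D : DFA α Prop := { step := fun s a => s ∧ p a, start := True, accept := {s | s} }
  convert! isRegular_of_finite D using 1
  ext w
  rw [DFA.mem_accepts]
  change _ ↔ D.eval w
  induction w using List.reverseRecOn with
  | nil => simp [mem_lettersIn, D]
  | append_singleton w a ih =>
    rw [DFA.eval_append_singleton]
    change _ ↔ D.eval w ∧ p a
    rw [← ih]
    simp [mem_lettersIn, or_imp, forall_and]

/-- The words that consist of a single letter satisfying a predicate. -/
def letter (p : α → Prop) : Language α := {w | ∃ a, p a ∧ w = [a]}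

theorem mem_letter {p : α → Prop} {w : List α} : w ∈ letter p ↔ ∃ a, p a ∧ w = [a] := Iff.rfl

open Classical in
theorem isRegular_letter (p : α → Prop) : (letter p).IsRegular := by
  let D : DFA α (Fin 3) :=
    { step := fun s a => if s = 0 ∧ p a then 1 else 2, start := 0, accept := {1} }
  convert! isRegular_of_finite D using 1
  ext w
  rw [DFA.mem_accepts]
  have h2 : ∀ v, D.evalFrom 2 v = 2 := by
    intro v
    induction v with
    | nil => rfl
    | cons a v ih => rw [DFA.evalFrom_cons]; simpa [D] using ih
  rcases w with _ | ⟨a, _ | ⟨b, w⟩⟩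
  · simp [mem_letter, D]
  · by_cases h : p a <;> simp [mem_letter, D, h]
  · have : D.eval (a :: b :: w) = 2 := by
      rw [DFA.eval, DFA.evalFrom_cons, DFA.evalFrom_cons]
      convert! h2 w using 2
      by_cases h : p a <;> simp [D, h]
    rw [this]
    simp [mem_letter, D]

theorem mem_singleton_word {v w : List α} : v ∈ ({w} : Language α) ↔ v = w := Iff.rfl

theorem isRegular_singleton_word (w : List α) : IsRegular ({w} : Language α) := by
  induction w with
  | nil =>
    have : ({[]} : Language α) = lettersIn fun _ => False := by
      ext w
      rw [mem_singleton_word, mem_lettersIn, List.eq_nil_iff_forall_not_mem]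
    exact this ▸ isRegular_lettersIn _
  | cons a w ih =>
    have : ({a :: w} : Language α) = letter (· = a) * {w} := by
      ext v
      simp [mem_mul, mem_letter, mem_singleton_word, eq_comm]
    exact this ▸ (isRegular_letter (· = a)).mul ih

/-- The inverse image of a language under a partial letter-to-letter map. -/
def filterMapPreimage {β : Type*} (f : α → Option β) (L : Language β) : Language α :=
  {w | w.filterMap f ∈ L}

theorem mem_filterMapPreimage {β : Type*} {f : α → Option β} {L : Language β} {w : List α} :
    w ∈ filterMapPreimage f L ↔ w.filterMap f ∈ L := Iff.rfl

theorem IsRegular.filterMapPreimage {β : Type*} {L : Language β} (hL : L.IsRegular)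
    (f : α → Option β) : (filterMapPreimage f L).IsRegular := by
  obtain ⟨σ, _, M, rfl⟩ := hL
  let D : DFA α σ :=
    { step := fun s a => (f a).elim s (M.step s), start := M.start, accept := M.accept }
  have key : ∀ w, D.eval w = M.eval (w.filterMap f) := by
    intro w
    induction w using List.reverseRecOn with
    | nil => rfl
    | append_singleton w a ih =>
      rw [DFA.eval_append_singleton, ih, List.filterMap_append]
      cases h : f a <;> simp [D, h]
  convert! isRegular_of_finite D using 1
  ext w
  rw [mem_filterMapPreimage, DFA.mem_accepts, DFA.mem_accepts, key]

end Language

/-! ### Interleavings over disjoint alphabets and their projections. -/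

namespace List

variable {α β : Type*}

theorem filterMap_getLeft?_inl (a : α) (w : List (α ⊕ β)) :
    (Sum.inl a :: w).filterMap Sum.getLeft? = a :: w.filterMap Sum.getLeft? := by
  simp

theorem filterMap_getLeft?_inr (b : β) (w : List (α ⊕ β)) :
    (Sum.inr b :: w).filterMap Sum.getLeft? = w.filterMap Sum.getLeft? := by
  simp [filterMap_cons]

theorem filterMap_getRight?_inl (a : α) (w : List (α ⊕ β)) :
    (Sum.inl a :: w).filterMap Sum.getRight? = w.filterMap Sum.getRight? := by
  simp [filterMap_cons]

theorem filterMap_getRight?_inr (b : β) (w : List (α ⊕ β)) :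
    (Sum.inr b :: w).filterMap Sum.getRight? = b :: w.filterMap Sum.getRight? := by
  simp

theorem filterMap_getLeft?_map_append (u : List α) (v : List β) :
    (u.map Sum.inl ++ v.map Sum.inr).filterMap Sum.getLeft? = u := by
  induction u with
  | nil => simp
  | cons a u ih => rw [map_cons, cons_append, filterMap_getLeft?_inl, ih]

theorem filterMap_getRight?_map_append (u : List α) (v : List β) :
    (u.map Sum.inl ++ v.map Sum.inr).filterMap Sum.getRight? = v := by
  induction u with
  | nil => induction v <;> simp_all
  | cons a u ih => rw [map_cons, cons_append, filterMap_getRight?_inl, ih]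

theorem eq_map_inl_of_filterMap_getRight? {w : List (α ⊕ β)}
    (h : w.filterMap Sum.getRight? = []) : w = (w.filterMap Sum.getLeft?).map Sum.inl := by
  induction w with
  | nil => rfl
  | cons c w ih =>
    cases c with
    | inl a =>
      rw [filterMap_getRight?_inl] at h
      rw [filterMap_getLeft?_inl, map_cons, ← ih h]
    | inr b => simp at h

theorem eq_map_inr_of_filterMap_getLeft? {w : List (α ⊕ β)}
    (h : w.filterMap Sum.getLeft? = []) : w = (w.filterMap Sum.getRight?).map Sum.inr := by
  induction w with
  | nil => rfl
  | cons c w ih =>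
    cases c with
    | inr a =>
      rw [filterMap_getLeft?_inr] at h
      rw [filterMap_getRight?_inr, map_cons, ← ih h]
    | inl b => simp at h

end List

/-- A word is an interleaving of two words over disjoint alphabets if and only if these are its
projections. -/
theorem mem_shuffle_map_iff {α β : Type*} (u : List α) (v : List β) (w : List (α ⊕ β)) :
    w ∈ shuffle (u.map Sum.inl) (v.map Sum.inr) ↔
      w.filterMap Sum.getLeft? = u ∧ w.filterMap Sum.getRight? = v := by
  induction w generalizing u v with
  | nil => cases u <;> cases v <;> simp [shuffle]
  | cons c w ih =>
    have left (u : List α) : (c :: w = u.map Sum.inl) ↔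
        (c :: w).filterMap Sum.getLeft? = u ∧ (c :: w).filterMap Sum.getRight? = ([] : List β) := by
      constructor
      · intro h
        rw [h]
        simpa using And.intro (List.filterMap_getLeft?_map_append u ([] : List β))
          (List.filterMap_getRight?_map_append u ([] : List β))
      · rintro ⟨rfl, h⟩
        exact List.eq_map_inl_of_filterMap_getRight? h
    have right (v : List β) : (c :: w = v.map Sum.inr) ↔
        (c :: w).filterMap Sum.getLeft? = ([] : List α) ∧
          (c :: w).filterMap Sum.getRight? = v := by
      constructor
      · intro h
        rw [h]
        exact ⟨List.filterMap_getLeft?_map_append ([] : List α) v,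
          List.filterMap_getRight?_map_append ([] : List α) v⟩
      · rintro ⟨h, rfl⟩
        exact List.eq_map_inr_of_filterMap_getLeft? h
    rcases u with _ | ⟨a, u⟩
    · rw [List.map_nil, shuffle, Set.mem_singleton_iff, right]
    rcases v with _ | ⟨b, v⟩
    · rw [List.map_cons, List.map_nil, shuffle, Set.mem_singleton_iff, ← left, List.map_cons]
    · have h1 := ih u (b :: v)
      have h2 := ih (a :: u) v
      rw [List.map_cons] at h1 h2
      rw [List.map_cons, List.map_cons, shuffle]
      simp only [Set.mem_union, Set.mem_image, List.cons.injEq]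
      cases c with
      | inl c =>
        simp only [Sum.inl.injEq, reduceCtorEq, false_and, and_false, exists_false, or_false,
          List.filterMap_cons, Sum.getLeft?_inl, Sum.getRight?_inl, List.cons.injEq]
        constructor
        · rintro ⟨x, hx, rfl, rfl⟩
          exact ⟨⟨rfl, (h1.1 hx).1⟩, (h1.1 hx).2⟩
        · rintro ⟨⟨rfl, h⟩, h'⟩
          exact ⟨w, h1.2 ⟨h, h'⟩, rfl, rfl⟩
      | inr c =>
        simp only [Sum.inr.injEq, reduceCtorEq, false_and, and_false, exists_false, false_or,
          List.filterMap_cons, Sum.getLeft?_inr, Sum.getRight?_inr, List.cons.injEq]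
        constructor
        · rintro ⟨x, hx, rfl, rfl⟩
          exact ⟨(h2.1 hx).1, rfl, (h2.1 hx).2⟩
        · rintro ⟨h, rfl, h'⟩
          exact ⟨w, h2.2 ⟨h, h'⟩, rfl, rfl⟩

/-! ### Regular witnesses that two images differ. -/

section Mismatch

variable {α β γ : Type*} (f : α → Option γ) (g : β → Option γ)

/-- The image under `f` of the letters of the first alphabet. -/
def leftImage : α ⊕ β → Option γ := Sum.elim f fun _ => none

/-- The image under `g` of the letters of the second alphabet. -/
def rightImage : α ⊕ β → Option γ := Sum.elim (fun _ => none) g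

theorem filterMap_leftImage (w : List (α ⊕ β)) :
    w.filterMap (leftImage f) = (w.filterMap Sum.getLeft?).filterMap f := by
  rw [List.filterMap_filterMap]
  congr 1
  funext c
  cases c <;> rfl

theorem filterMap_rightImage (w : List (α ⊕ β)) :
    w.filterMap (rightImage g) = (w.filterMap Sum.getRight?).filterMap g := by
  rw [List.filterMap_filterMap]
  congr 1
  funext c
  cases c <;> rfl

/-- Short words on whose two sides the images are the same. -/
def matchBlock : Language (α ⊕ β) :=
  Language.letter (fun c => leftImage f c = none ∧ rightImage g c = none) +
    ⨆ x : γ, Language.letter (fun c => leftImage f c = some x) *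
      Language.letter (fun c => rightImage g c = some x)

/-- Words whose two sides have images that differ in the first letter. -/
def mismatchTail : Language (α ⊕ β) :=
  (⨆ p : {p : γ × γ // p.1 ≠ p.2}, Language.letter (fun c => leftImage f c = some p.1.1) *
      (Language.letter (fun c => rightImage g c = some p.1.2) * Language.lettersIn fun _ => True)) +
    Language.letter (fun c => leftImage f c ≠ none) * Language.lettersIn (fun c => c.isLeft) +
    Language.letter (fun c => rightImage g c ≠ none) * Language.lettersIn (fun c => c.isRight)

/-- A regular language of witnesses that the image of the first projection under `f` differs from
the image of the second projection under `g`. -/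
def mismatch : Language (α ⊕ β) := (matchBlock f g)∗ * mismatchTail f g

theorem Language.IsRegular.iSup {ι δ : Type*} [Finite ι] {L : ι → Language δ}
    (hL : ∀ i, (L i).IsRegular) : (⨆ i, L i).IsRegular := by
  have h : ∀ s : Finset ι, (⨆ i ∈ s, L i).IsRegular := by
    classical
    intro s
    induction s using Finset.induction_on with
    | empty =>
      have : (⨆ i ∈ (∅ : Finset ι), L i) = (Language.letter fun _ => False : Language δ) := by
        simp only [Finset.notMem_empty, iSup_false, iSup_bot]
        refine Language.ext fun w => ?_
        simp only [Language.mem_letter, false_and, exists_false, iff_false]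
        exact id
      exact this ▸ Language.isRegular_letter _
    | insert i s _ ih =>
      rw [Finset.iSup_insert]
      exact (hL i).add ih
  have := Fintype.ofFinite ι
  simpa using h Finset.univ

theorem isRegular_mismatch [Finite γ] : (mismatch f g).IsRegular := by
  refine .mul (.kstar (.add (Language.isRegular_letter _) (.iSup fun _ => ?_)))
    (.add (.add (.iSup fun _ => ?_) ?_) ?_)
  · exact (Language.isRegular_letter _).mul (Language.isRegular_letter _)
  · exact (Language.isRegular_letter _).mul
      ((Language.isRegular_letter _).mul (Language.isRegular_lettersIn _))
  · exact (Language.isRegular_letter _).mul (Language.isRegular_lettersIn _)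
  · exact (Language.isRegular_letter _).mul (Language.isRegular_lettersIn _)

/-- Each match block adds the same to both images. After this common prefix is cancelled, the tail
shows either two different first letters or a nonempty image against an empty one. -/
theorem filterMap_ne_of_mem_mismatch {w : List (α ⊕ β)} (hw : w ∈ mismatch f g) :
    w.filterMap (leftImage f) ≠ w.filterMap (rightImage g) := by
  have lr : ∀ c : α ⊕ β, ∀ x, leftImage f c = some x → rightImage g c = none := by
    rintro (c | c) x <;> simp [leftImage, rightImage]
  have rl : ∀ c : α ⊕ β, ∀ x, rightImage g c = some x → leftImage f c = none := by
    rintro (c | c) x <;> simp [leftImage, rightImage]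
  obtain ⟨x, hx, y, hy, rfl⟩ := Language.mem_mul.1 hw
  have h1 : x.filterMap (leftImage f) = x.filterMap (rightImage g) := by
    refine Language.kstar_induction
      (p := fun x => x.filterMap (leftImage f) = x.filterMap (rightImage g)) rfl
      (fun x hx y _ ih => ?_) hx
    ·
      rw [List.filterMap_append, List.filterMap_append, ih]
      congr 1
      rcases (Language.mem_add _ _ _).1 hx with ⟨c, hc, rfl⟩ | hx
      · simp [hc.1, hc.2]
      · obtain ⟨z, hx⟩ := Language.mem_iSup.1 hx
        obtain ⟨_, ⟨c, hc, rfl⟩, _, ⟨d, hd, rfl⟩, rfl⟩ := Language.mem_mul.1 hx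
        simp [hc, hd, lr _ _ hc, rl _ _ hd]
  rw [List.filterMap_append, List.filterMap_append, h1]
  intro h
  have h := List.append_cancel_left h
  rcases (Language.mem_add _ _ _).1 hy with hy | hy
  · rcases (Language.mem_add _ _ _).1 hy with hy | hy
    · obtain ⟨⟨⟨p, q⟩, hpq⟩, hy⟩ := Language.mem_iSup.1 hy
      obtain ⟨_, ⟨c, hc, rfl⟩, _, hy', rfl⟩ := Language.mem_mul.1 hy
      obtain ⟨_, ⟨d, hd, rfl⟩, r, _, rfl⟩ := Language.mem_mul.1 hy'
      simp [hc, hd, lr _ _ hc, rl _ _ hd] at h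
      exact hpq h.1
    · obtain ⟨_, ⟨c, hc, rfl⟩, r, hr, rfl⟩ := Language.mem_mul.1 hy
      obtain ⟨z, hz⟩ := Option.ne_none_iff_exists'.1 hc
      have : r.filterMap (rightImage g) = [] := by
        rw [List.filterMap_eq_nil_iff]
        intro d hd
        have := hr d hd
        cases d <;> simp_all [rightImage]
      simp [hz, lr _ _ hz, this] at h
  · obtain ⟨_, ⟨c, hc, rfl⟩, r, hr, rfl⟩ := Language.mem_mul.1 hy
    obtain ⟨z, hz⟩ := Option.ne_none_iff_exists'.1 hc
    have : r.filterMap (leftImage f) = [] := by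
      rw [List.filterMap_eq_nil_iff]
      intro d hd
      have := hr d hd
      cases d <;> simp_all [leftImage]
    simp [hz, rl _ _ hz, this] at h

/-- The interleaving is built greedily: letters with no image are emitted alone, equal heads are
emitted as a pair, and at the first disagreement, or when one word is exhausted, the remaining
letters are emitted as a tail. -/
theorem exists_mem_mismatch (u : List α) (v : List β) (h : u.filterMap f ≠ v.filterMap g) :
    ∃ w ∈ mismatch f g, w.filterMap Sum.getLeft? = u ∧ w.filterMap Sum.getRight? = v := by
  have tail {w : List (α ⊕ β)} (hw : w ∈ mismatchTail f g) : w ∈ mismatch f g :=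
    Language.append_mem_mul (Language.nil_mem_kstar _) hw
  have skip {x w : List (α ⊕ β)} (hx : x ∈ matchBlock f g) (hw : w ∈ mismatch f g) :
      x ++ w ∈ mismatch f g := by
    obtain ⟨y, hy, z, hz, rfl⟩ := Language.mem_mul.1 hw
    rw [← List.append_assoc]
    exact Language.append_mem_mul (Language.cons_mem_kstar hx hy) hz
  have L1 := List.filterMap_getLeft?_inl (α := α) (β := β)
  have L2 := List.filterMap_getLeft?_inr (α := α) (β := β)
  have R1 := List.filterMap_getRight?_inl (α := α) (β := β)
  have R2 := List.filterMap_getRight?_inr (α := α) (β := β)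
  have LA := List.filterMap_getLeft?_map_append (α := α) (β := β)
  have RA := List.filterMap_getRight?_map_append (α := α) (β := β)
  induction u generalizing v with
  | nil =>
    induction v with
    | nil => exact absurd rfl h
    | cons b v ih =>
      cases hb : g b with
      | none =>
        obtain ⟨w, hw, h1, h2⟩ := ih (by simpa [hb] using h)
        exact ⟨[Sum.inr b] ++ w, skip (Or.inl ⟨Sum.inr b, ⟨rfl, hb⟩, rfl⟩) hw, by simp [L2, h1],
          by simp [R2, h2]⟩
      | some z =>
        refine ⟨[Sum.inr b] ++ v.map Sum.inr, tail (Or.inr (Language.append_mem_mul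
          ⟨_, ?_, rfl⟩ ?_)), ?_, ?_⟩
        · simp [rightImage, hb]
        · intro c hc
          obtain ⟨d, _, rfl⟩ := List.mem_map.1 hc
          rfl
        · rw [List.singleton_append, L2]
          exact LA [] v
        · rw [List.singleton_append, R2]
          exact congrArg _ (RA [] v)
  | cons a u ih =>
    cases ha : f a with
    | none =>
      obtain ⟨w, hw, h1, h2⟩ := ih v (by simpa [ha] using h)
      exact ⟨[Sum.inl a] ++ w, skip (Or.inl ⟨Sum.inl a, ⟨ha, rfl⟩, rfl⟩) hw, by simp [L1, h1],
        by simp [R1, h2]⟩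
    | some y =>
      induction v with
      | nil =>
        refine ⟨[Sum.inl a] ++ u.map Sum.inl, tail (Or.inl (Or.inr (Language.append_mem_mul
          ⟨_, ?_, rfl⟩ ?_))), ?_, ?_⟩
        · simp [leftImage, ha]
        · intro c hc
          obtain ⟨d, _, rfl⟩ := List.mem_map.1 hc
          rfl
        · have := LA u []
          rw [List.map_nil, List.append_nil] at this
          rw [List.singleton_append, L1, this]
        · have := RA u []
          rw [List.map_nil, List.append_nil] at this
          rw [List.singleton_append, R1, this]
      | cons b v ihv =>
        cases hb : g b with
        | none =>
          obtain ⟨w, hw, h1, h2⟩ := ihv (by simpa [hb] using h)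
          exact ⟨[Sum.inr b] ++ w, skip (Or.inl ⟨Sum.inr b, ⟨rfl, hb⟩, rfl⟩) hw, by simp [L2, h1],
            by simp [R2, h2]⟩
        | some z =>
          by_cases hyz : y = z
          · subst hyz
            obtain ⟨w, hw, h1, h2⟩ := ih v (by simpa [ha, hb] using h)
            refine ⟨([Sum.inl a] ++ [Sum.inr b]) ++ w, skip (Or.inr (Language.mem_iSup.2
              ⟨y, Language.append_mem_mul ⟨Sum.inl a, ha, rfl⟩ ⟨Sum.inr b, hb, rfl⟩⟩)) hw,
              by simp [L1, L2, h1],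
              by simp [R1, R2, h2]⟩
          · refine ⟨[Sum.inl a] ++ ([Sum.inr b] ++ (u.map Sum.inl ++ v.map Sum.inr)),
              tail (Or.inl (Or.inl (Language.mem_iSup.2 ⟨⟨(y, z), hyz⟩,
                Language.append_mem_mul ⟨Sum.inl a, ha, rfl⟩
                  (Language.append_mem_mul ⟨Sum.inr b, hb, rfl⟩
                  fun _ _ => trivial)⟩))), ?_, ?_⟩
            · rw [List.singleton_append, List.singleton_append, L1, L2, LA]
            · rw [List.singleton_append, List.singleton_append, R1, R2, RA]

theorem exists_mem_mismatch_iff (u : List α) (v : List β) :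
    (∃ w ∈ mismatch f g, w.filterMap Sum.getLeft? = u ∧ w.filterMap Sum.getRight? = v) ↔
      u.filterMap f ≠ v.filterMap g := by
  refine ⟨?_, exists_mem_mismatch f g u v⟩
  rintro ⟨w, hw, rfl, rfl⟩
  rw [← filterMap_leftImage, ← filterMap_rightImage]
  exact filterMap_ne_of_mem_mismatch f g hw

end Mismatch

/-! ### Trace letters and their four tracks. -/

/-- The letters of the words that encode stacks of lists of natural numbers: `one` is a unary digit,
`com` ends a number and `sem` ends a list. -/
inductive StackChar
  | one
  | com
  | sem
  deriving DecidableEq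

instance : Fintype StackChar :=
  ⟨{.one, .com, .sem}, fun c => by cases c <;> simp⟩

/-- The letters of a trace.  The second component is a character, or `none` for the mark that ends
a round.  The flags tell on which of the four tracks (input of a round, output of a round, and two
tracks used to compare parts of a round) the character is written. -/
abbrev TraceLetter := (Bool × Bool × Bool × Bool) × Option StackChar

namespace TraceLetter

/-- The character on the input track. -/
def inp (x : TraceLetter) : Option (Option StackChar) := bif x.1.1 then some x.2 else none

/-- The character on the output track. -/
def out (x : TraceLetter) : Option (Option StackChar) := bif x.1.2.1 then some x.2 else none

/-- The character on the first comparison track. -/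
def cmpA (x : TraceLetter) : Option (Option StackChar) := bif x.1.2.2.1 then some x.2 else none

/-- The character on the second comparison track. -/
def cmpB (x : TraceLetter) : Option (Option StackChar) := bif x.1.2.2.2 then some x.2 else none

/-- The mark that ends a round. -/
def mark : TraceLetter := ((true, true, true, true), none)

/-- The letter that is used for the unary digits of the initial input only. -/
def digit : TraceLetter := ((false, true, true, true), some .one)

/-- The word `w`, written on the tracks given by the flags. -/
def tag (F : Bool × Bool × Bool × Bool) (w : List StackChar) : List TraceLetter :=
  w.map fun c => (F, some c)

section tag

variable (F : Bool × Bool × Bool × Bool) (w : List StackChar)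

@[simp] theorem filterMap_inp_tag :
    (tag F w).filterMap inp = bif F.1 then w.map some else [] := by
  rw [tag, List.filterMap_map]
  rcases F with ⟨_ | _, F⟩ <;> induction w <;> simp_all [inp, Function.comp_def]

@[simp] theorem filterMap_out_tag :
    (tag F w).filterMap out = bif F.2.1 then w.map some else [] := by
  rw [tag, List.filterMap_map]
  rcases F with ⟨_, _ | _, F⟩ <;> induction w <;> simp_all [out, Function.comp_def]

@[simp] theorem filterMap_cmpA_tag :
    (tag F w).filterMap cmpA = bif F.2.2.1 then w.map some else [] := by
  rw [tag, List.filterMap_map]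
  rcases F with ⟨_, _, _ | _, F⟩ <;> induction w <;> simp_all [cmpA, Function.comp_def]

@[simp] theorem filterMap_cmpB_tag :
    (tag F w).filterMap cmpB = bif F.2.2.2 then w.map some else [] := by
  rw [tag, List.filterMap_map]
  rcases F with ⟨_, _, _, _ | _⟩ <;> induction w <;> simp_all [cmpB, Function.comp_def]

end tag

theorem digit_notMem_tag {F : Bool × Bool × Bool × Bool} (hF : F ≠ (false, true, true, true))
    (w : List StackChar) : digit ∉ tag F w := by
  intro h
  obtain ⟨c, _, hc⟩ := List.mem_map.1 h
  exact hF (congrArg Prod.fst hc)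

/-- The words over the characters satisfying `p`, written on the tracks given by the flags. -/
def segment (F : Bool × Bool × Bool × Bool) (p : StackChar → Prop) : Language TraceLetter :=
  Language.lettersIn fun x => x.1 = F ∧ ∃ c, p c ∧ x.2 = some c

theorem mem_segment {F : Bool × Bool × Bool × Bool} {p : StackChar → Prop}
    {u : List TraceLetter} : u ∈ segment F p ↔
      ∃ w : List StackChar, (∀ c ∈ w, p c) ∧ u = tag F w := by
  constructor
  · intro h
    induction u with
    | nil => exact ⟨[], by simp, rfl⟩
    | cons x u ih =>
      obtain ⟨w, hw, rfl⟩ := ih fun y hy => h y (List.mem_cons_of_mem _ hy)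
      obtain ⟨hF, c, hc, hx⟩ := h x List.mem_cons_self
      obtain ⟨x, y⟩ := x
      obtain rfl : x = F := hF
      obtain rfl : y = some c := hx
      exact ⟨c :: w, by simpa using ⟨hc, hw⟩, rfl⟩
  · rintro ⟨w, hw, rfl⟩ x hx
    obtain ⟨c, hc, rfl⟩ := List.mem_map.1 hx
    exact ⟨rfl, c, hw c hc, rfl⟩

theorem isRegular_segment (F : Bool × Bool × Bool × Bool) (p : StackChar → Prop) :
    (segment F p).IsRegular := Language.isRegular_lettersIn _

end TraceLetter

open TraceLetter

/-! ### Relations on words implemented by regular languages of traces. -/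

/-- A word is split uniquely at the first end mark. -/
theorem List.map_some_append_none_inj {α : Type*} {v w : List α} {x y : List (Option α)}
    (h : v.map some ++ none :: x = w.map some ++ none :: y) : v = w ∧ x = y := by
  induction v generalizing w with
  | nil => cases w <;> simp_all
  | cons a v ih =>
    cases w with
    | nil => simp at h
    | cons b w =>
      simp only [List.map_cons, List.cons_append, List.cons.injEq, Option.some.injEq] at h
      obtain ⟨rfl, h⟩ := h
      obtain ⟨rfl, rfl⟩ := ih h
      exact ⟨rfl, rfl⟩

/-- The regular language `X` of traces implements the relation `r` on stack words: on a trace in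
`X` that is consistent on the input and output tracks and on the comparison tracks, the stack word
before the trace is related to the stack word after it, and every related pair has such a trace. -/
structure Implements (X : Language TraceLetter) (r : List StackChar → List StackChar → Prop) :
    Prop where
  isRegular : X.IsRegular
  digit_notMem : ∀ u ∈ X, digit ∉ u
  sound : ∀ u ∈ X, ∀ (d : List StackChar) (i o a b : List (Option StackChar)),
    d.map some ++ none :: (u.filterMap out ++ o) = u.filterMap inp ++ i →
    u.filterMap cmpA ++ a = u.filterMap cmpB ++ b →
    ∃ d', r d d' ∧ d'.map some ++ none :: o = i ∧ a = b
  complete : ∀ d d', r d d' → ∃ u ∈ X,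
    d.map some ++ none :: u.filterMap out = u.filterMap inp ++ (d'.map some ++ [none]) ∧
    u.filterMap cmpA = u.filterMap cmpB

/-- A relation on stack words that is implemented by some regular language of traces. -/
def Implementable (r : List StackChar → List StackChar → Prop) : Prop := ∃ X, Implements X r

namespace Implementable

variable {r s : List StackChar → List StackChar → Prop}

/-- The output not yet read acts as a queue whose content is the current stack word. Soundness is
stated with arbitrary continuations of all tracks, so the equation left over after the first trace
is the hypothesis for the second. -/
theorem comp (hr : Implementable r) (hs : Implementable s) : Implementable (Relation.Comp r s) := by
  obtain ⟨X, hX⟩ := hr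
  obtain ⟨Y, hY⟩ := hs
  refine ⟨X * Y, hX.isRegular.mul hY.isRegular, ?_, ?_, ?_⟩
  · rintro _ ⟨u, hu, v, hv, rfl⟩ h
    rcases List.mem_append.1 h with h | h
    exacts [hX.digit_notMem u hu h, hY.digit_notMem v hv h]
  · rintro _ ⟨u, hu, v, hv, rfl⟩ d i o a b h1 h2
    simp only [List.filterMap_append, List.append_assoc] at h1 h2
    obtain ⟨d', hd', h1, h2⟩ := hX.sound u hu d _ _ _ _ h1 h2
    obtain ⟨d'', hd'', h1, h2⟩ := hY.sound v hv d' _ _ _ _ h1 h2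
    exact ⟨d'', ⟨d', hd', hd''⟩, h1, h2⟩
  · rintro d d'' ⟨d', h, h'⟩
    obtain ⟨u, hu, h1, h2⟩ := hX.complete _ _ h
    obtain ⟨v, hv, h3, h4⟩ := hY.complete _ _ h'
    refine ⟨u ++ v, Language.append_mem_mul hu hv, ?_, by simp [h2, h4]⟩
    rw [List.filterMap_append, List.filterMap_append, List.append_assoc, ← h3,
      ← List.cons_append, ← List.append_assoc, h1]
    simp

theorem or (hr : Implementable r) (hs : Implementable s) :
    Implementable fun d d' => r d d' ∨ s d d' := by
  obtain ⟨X, hX⟩ := hr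
  obtain ⟨Y, hY⟩ := hs
  refine ⟨X + Y, hX.isRegular.add hY.isRegular, ?_, ?_, ?_⟩
  · rintro u (hu | hu)
    exacts [hX.digit_notMem u hu, hY.digit_notMem u hu]
  · rintro u (hu | hu) d i o a b h1 h2
    · obtain ⟨d', h, h'⟩ := hX.sound u hu d _ _ _ _ h1 h2
      exact ⟨d', Or.inl h, h'⟩
    · obtain ⟨d', h, h'⟩ := hY.sound u hu d _ _ _ _ h1 h2
      exact ⟨d', Or.inr h, h'⟩
  · rintro d d' (h | h)
    · obtain ⟨u, hu, h⟩ := hX.complete _ _ h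
      exact ⟨u, Or.inl hu, h⟩
    · obtain ⟨u, hu, h⟩ := hY.complete _ _ h
      exact ⟨u, Or.inr hu, h⟩

theorem reflTransGen (hr : Implementable r) : Implementable (Relation.ReflTransGen r) := by
  obtain ⟨X, hX⟩ := hr
  refine ⟨X∗, hX.isRegular.kstar, ?_, ?_, ?_⟩
  · intro u hu
    refine Language.kstar_induction (p := fun u => digit ∉ u) (by simp) (fun u hu v _ ih h => ?_) hu
    rcases List.mem_append.1 h with h | h
    exacts [hX.digit_notMem u hu h, ih h]
  · intro u hu
    refine Language.kstar_induction (p := fun u => ∀ (d : List StackChar)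
      (i o a b : List (Option StackChar)),
      d.map some ++ none :: (u.filterMap out ++ o) = u.filterMap inp ++ i →
      u.filterMap cmpA ++ a = u.filterMap cmpB ++ b →
      ∃ d', Relation.ReflTransGen r d d' ∧ d'.map some ++ none :: o = i ∧ a = b)
      (fun d i o a b h1 h2 => ⟨d, .refl, h1, h2⟩) (fun u hu v _ ih d i o a b h1 h2 => ?_) hu
    simp only [List.filterMap_append, List.append_assoc] at h1 h2
    obtain ⟨d', hd', h1, h2⟩ := hX.sound u hu d _ _ _ _ h1 h2
    obtain ⟨d'', hd'', h1, h2⟩ := ih d' _ _ _ _ h1 h2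
    exact ⟨d'', .head hd' hd'', h1, h2⟩
  · intro d d'' h
    induction h using Relation.ReflTransGen.head_induction_on with
    | refl => exact ⟨[], Language.nil_mem_kstar _, by simp, rfl⟩
    | head h _ ih =>
      obtain ⟨u, hu, h1, h2⟩ := hX.complete _ _ h
      obtain ⟨v, hv, h3, h4⟩ := ih
      refine ⟨u ++ v, Language.cons_mem_kstar hu hv, ?_, by simp [h2, h4]⟩
      rw [List.filterMap_append, List.filterMap_append, List.append_assoc, ← h3,
        ← List.cons_append, ← List.append_assoc, h1]
      simp

/-- A relation that is implemented by a regular language of single rounds is implementable. -/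
theorem of_round {Y : Language TraceLetter} (hY : Y.IsRegular) (digit_notMem : ∀ u ∈ Y, digit ∉ u)
    (sound : ∀ u ∈ Y, ∃ d d' a b : List StackChar, u.filterMap inp = d.map some ∧
      u.filterMap out = d'.map some ∧ u.filterMap cmpA = a.map some ∧
      u.filterMap cmpB = b.map some ∧ (a = b → r d d'))
    (complete : ∀ d d', r d d' → ∃ u ∈ Y, u.filterMap inp = d.map some ∧
      u.filterMap out = d'.map some ∧ u.filterMap cmpA = u.filterMap cmpB) :
    Implementable r := by
  refine ⟨Y * {[mark]}, hY.mul (Language.isRegular_singleton_word _), ?_, ?_, ?_⟩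
  · rintro _ ⟨u, hu, _, rfl, rfl⟩ h
    rcases List.mem_append.1 h with h | h
    · exact digit_notMem u hu h
    · simp [digit, mark] at h
  · rintro _ ⟨u, hu, _, rfl, rfl⟩ d i o a b h1 h2
    obtain ⟨e, e', a', b', hi, ho, ha, hb, hr⟩ := sound u hu
    simp only [List.filterMap_append, hi, ho, ha, hb, List.append_assoc, mark, inp, out, cmpA, cmpB,
      List.filterMap_cons, List.filterMap_nil, cond_true, List.singleton_append] at h1 h2
    -- The end marks synchronize the tracks: the word read in this round is exactly the pending word
    -- `d`, and the comparison tracks agree on this round separately from all later ones.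
    obtain ⟨rfl, h3⟩ := List.map_some_append_none_inj h1
    obtain ⟨rfl, h4⟩ := List.map_some_append_none_inj h2
    exact ⟨e', hr rfl, h3, h4⟩
  · intro d d' h
    obtain ⟨u, hu, hi, ho, hab⟩ := complete d d' h
    refine ⟨u ++ [mark], Language.append_mem_mul hu rfl, ?_, ?_⟩
    · simp [hi, ho, mark, inp, out]
    · simp [hab, mark, cmpA, cmpB]

/-! ### Stack operations performed in a single round. -/

section Basic

/-- Unchanged part of a round. -/
local notation "kept" => (true, true, false, false)

/-- Deleted part of a round. -/
local notation "deleted" => (true, false, false, false)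

/-- Inserted part of a round. -/
local notation "inserted" => (false, true, false, false)

theorem push (c : StackChar) : Implementable fun d d' => d' = c :: d := by
  refine of_round (Y := {tag inserted [c]} * segment kept fun _ => True)
    (.mul (Language.isRegular_singleton_word _) (isRegular_segment _ _)) ?_ ?_ ?_
  · rintro _ ⟨_, rfl, _, hv, rfl⟩
    obtain ⟨v, -, rfl⟩ := mem_segment.1 hv
    simp [digit_notMem_tag]
  · rintro _ ⟨_, rfl, _, hv, rfl⟩
    obtain ⟨v, -, rfl⟩ := mem_segment.1 hv
    exact ⟨v, c :: v, [], [], by simp, by simp, by simp, by simp, fun _ => rfl⟩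
  · rintro d _ rfl
    exact ⟨_, Language.append_mem_mul rfl (mem_segment.2 ⟨d, by simp, rfl⟩), by simp, by simp,
      by simp⟩

theorem pop (c : StackChar) : Implementable fun d d' => d = c :: d' := by
  refine of_round (Y := {tag deleted [c]} * segment kept fun _ => True)
    (.mul (Language.isRegular_singleton_word _) (isRegular_segment _ _)) ?_ ?_ ?_
  · rintro _ ⟨_, rfl, _, hv, rfl⟩
    obtain ⟨v, -, rfl⟩ := mem_segment.1 hv
    simp [digit_notMem_tag]
  · rintro _ ⟨_, rfl, _, hv, rfl⟩
    obtain ⟨v, -, rfl⟩ := mem_segment.1 hv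
    exact ⟨c :: v, v, [], [], by simp, by simp, by simp, by simp, fun _ => rfl⟩
  · rintro _ d rfl
    exact ⟨_, Language.append_mem_mul rfl (mem_segment.2 ⟨d, by simp, rfl⟩), by simp, by simp,
      by simp⟩

/-- Duplication of the topmost list. -/
theorem dup : Implementable fun d d' => ∃ v y : List StackChar, (∀ c ∈ v, c ≠ .sem) ∧
    d = v ++ .sem :: y ∧ d' = v ++ .sem :: (v ++ .sem :: y) := by
  -- The list is kept and also written on the first comparison track. The second copy is guessed: it
  -- is output and written on the second comparison track, whose equality with the first makes the
  -- guess correct.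
  refine of_round (Y := segment (true, true, true, false) (· ≠ .sem) * ({tag kept [.sem]} *
      (segment (false, true, false, true) (· ≠ .sem) * ({tag inserted [.sem]} *
        segment kept fun _ => True))))
    (.mul (isRegular_segment _ _) (.mul (Language.isRegular_singleton_word _)
      (.mul (isRegular_segment _ _) (.mul (Language.isRegular_singleton_word _)
        (isRegular_segment _ _))))) ?_ ?_ ?_
  · rintro _ ⟨_, hv, _, ⟨_, rfl, _, ⟨_, hw, _, ⟨_, rfl, _, hy, rfl⟩, rfl⟩, rfl⟩, rfl⟩
    obtain ⟨v, -, rfl⟩ := mem_segment.1 hv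
    obtain ⟨w, -, rfl⟩ := mem_segment.1 hw
    obtain ⟨y, -, rfl⟩ := mem_segment.1 hy
    simp [digit_notMem_tag]
  · rintro _ ⟨_, hv, _, ⟨_, rfl, _, ⟨_, hw, _, ⟨_, rfl, _, hy, rfl⟩, rfl⟩, rfl⟩, rfl⟩
    obtain ⟨v, hv', rfl⟩ := mem_segment.1 hv
    obtain ⟨w, -, rfl⟩ := mem_segment.1 hw
    obtain ⟨y, -, rfl⟩ := mem_segment.1 hy
    refine ⟨v ++ .sem :: y, v ++ .sem :: (w ++ .sem :: y), v, w, by simp, by simp, by simp,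
      by simp, ?_⟩
    rintro rfl
    exact ⟨v, y, hv', rfl, rfl⟩
  · rintro _ _ ⟨v, y, hv, rfl, rfl⟩
    exact ⟨_, Language.append_mem_mul (mem_segment.2 ⟨v, hv, rfl⟩) (Language.append_mem_mul rfl
      (Language.append_mem_mul (mem_segment.2 ⟨v, hv, rfl⟩) (Language.append_mem_mul rfl
        (mem_segment.2 ⟨y, by simp, rfl⟩)))), by simp, by simp, by simp⟩

/-- Exchange of the two topmost lists. -/
theorem swap : Implementable fun d d' => ∃ v w y : List StackChar, (∀ c ∈ v, c ≠ .sem) ∧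
    (∀ c ∈ w, c ≠ .sem) ∧ d = v ++ .sem :: (w ++ .sem :: y) ∧
      d' = w ++ .sem :: (v ++ .sem :: y) := by
  -- The top list is deleted in its old place but recorded on the first comparison track; the list
  -- guessed behind the second one must match it on the other comparison track.
  refine of_round (Y := segment (true, false, true, false) (· ≠ .sem) * ({tag deleted [.sem]} *
      (segment kept (· ≠ .sem) * ({tag kept [.sem]} * (segment (false, true, false, true)
        (· ≠ .sem) * ({tag inserted [.sem]} * segment kept fun _ => True))))))
    (.mul (isRegular_segment _ _) (.mul (Language.isRegular_singleton_word _)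
      (.mul (isRegular_segment _ _) (.mul (Language.isRegular_singleton_word _)
        (.mul (isRegular_segment _ _) (.mul (Language.isRegular_singleton_word _)
          (isRegular_segment _ _))))))) ?_ ?_ ?_
  · rintro _ ⟨_, hv, _, ⟨_, rfl, _, ⟨_, hw, _, ⟨_, rfl, _, ⟨_, hx, _, ⟨_, rfl, _, hy, rfl⟩, rfl⟩,
      rfl⟩, rfl⟩, rfl⟩, rfl⟩
    obtain ⟨v, -, rfl⟩ := mem_segment.1 hv
    obtain ⟨w, -, rfl⟩ := mem_segment.1 hw
    obtain ⟨x, -, rfl⟩ := mem_segment.1 hx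
    obtain ⟨y, -, rfl⟩ := mem_segment.1 hy
    simp [digit_notMem_tag]
  · rintro _ ⟨_, hv, _, ⟨_, rfl, _, ⟨_, hw, _, ⟨_, rfl, _, ⟨_, hx, _, ⟨_, rfl, _, hy, rfl⟩, rfl⟩,
      rfl⟩, rfl⟩, rfl⟩, rfl⟩
    obtain ⟨v, hv', rfl⟩ := mem_segment.1 hv
    obtain ⟨w, hw', rfl⟩ := mem_segment.1 hw
    obtain ⟨x, -, rfl⟩ := mem_segment.1 hx
    obtain ⟨y, -, rfl⟩ := mem_segment.1 hy
    refine ⟨v ++ .sem :: (w ++ .sem :: y), w ++ .sem :: (x ++ .sem :: y), v, x, by simp, by simp,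
      by simp, by simp, ?_⟩
    rintro rfl
    exact ⟨v, w, y, hv', hw', rfl, rfl⟩
  · rintro _ _ ⟨v, w, y, hv, hw, rfl, rfl⟩
    exact ⟨_, Language.append_mem_mul (mem_segment.2 ⟨v, hv, rfl⟩) (Language.append_mem_mul rfl
      (Language.append_mem_mul (mem_segment.2 ⟨w, hw, rfl⟩) (Language.append_mem_mul rfl
        (Language.append_mem_mul (mem_segment.2 ⟨v, hv, rfl⟩) (Language.append_mem_mul rfl
          (mem_segment.2 ⟨y, by simp, rfl⟩)))))), by simp, by simp, by simp⟩

/-- Replacement of the tail of the topmost list by the list below it. -/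
theorem cut : Implementable fun d d' => ∃ v w y : List StackChar, (∀ c ∈ v, c = .one) ∧
    (∀ c ∈ w, c ≠ .sem) ∧ d = v ++ .com :: (w ++ .sem :: y) ∧ d' = v ++ .com :: y := by
  refine of_round (Y := segment kept (· = .one) * ({tag kept [.com]} *
      (segment deleted (· ≠ .sem) * ({tag deleted [.sem]} * segment kept fun _ => True))))
    (.mul (isRegular_segment _ _) (.mul (Language.isRegular_singleton_word _)
      (.mul (isRegular_segment _ _) (.mul (Language.isRegular_singleton_word _)
        (isRegular_segment _ _))))) ?_ ?_ ?_
  · rintro _ ⟨_, hv, _, ⟨_, rfl, _, ⟨_, hw, _, ⟨_, rfl, _, hy, rfl⟩, rfl⟩, rfl⟩, rfl⟩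
    obtain ⟨v, -, rfl⟩ := mem_segment.1 hv
    obtain ⟨w, -, rfl⟩ := mem_segment.1 hw
    obtain ⟨y, -, rfl⟩ := mem_segment.1 hy
    simp [digit_notMem_tag]
  · rintro _ ⟨_, hv, _, ⟨_, rfl, _, ⟨_, hw, _, ⟨_, rfl, _, hy, rfl⟩, rfl⟩, rfl⟩, rfl⟩
    obtain ⟨v, hv', rfl⟩ := mem_segment.1 hv
    obtain ⟨w, hw', rfl⟩ := mem_segment.1 hw
    obtain ⟨y, -, rfl⟩ := mem_segment.1 hy
    exact ⟨v ++ .com :: (w ++ .sem :: y), v ++ .com :: y, [], [], by simp, by simp, by simp,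
      by simp, fun _ => ⟨v, w, y, hv', hw', rfl, rfl⟩⟩
  · rintro _ _ ⟨v, w, y, hv, hw, rfl, rfl⟩
    exact ⟨_, Language.append_mem_mul (mem_segment.2 ⟨v, hv, rfl⟩) (Language.append_mem_mul rfl
      (Language.append_mem_mul (mem_segment.2 ⟨w, hw, rfl⟩) (Language.append_mem_mul rfl
        (mem_segment.2 ⟨y, by simp, rfl⟩)))), by simp, by simp, by simp⟩

end Basic

end Implementable

/-! ### Encoded stacks of lists and the operations on them. -/

open Relation

theorem List.append_cons_inj_of_forall_ne {α : Type*} {s : α} {v w x y : List α}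
    (hv : ∀ c ∈ v, c ≠ s) (hw : ∀ c ∈ w, c ≠ s) (h : v ++ s :: x = w ++ s :: y) :
    v = w ∧ x = y := by
  induction v generalizing w with
  | nil =>
    cases w with
    | nil => simpa using h
    | cons b w =>
      rw [List.nil_append, List.cons_append, List.cons.injEq] at h
      exact absurd h.1.symm (hw b List.mem_cons_self)
  | cons a v ih =>
    cases w with
    | nil =>
      rw [List.nil_append, List.cons_append, List.cons.injEq] at h
      exact absurd h.1 (hv a List.mem_cons_self)
    | cons b w =>
      rw [List.cons_append, List.cons_append, List.cons.injEq] at h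
      obtain ⟨rfl, rfl⟩ := ih (fun c hc => hv c (List.mem_cons_of_mem _ hc))
        (fun c hc => hw c (List.mem_cons_of_mem _ hc)) h.2
      exact ⟨by rw [h.1], rfl⟩

/-- A nonempty stack of lists of natural numbers, as its top and the rest. -/
abbrev Stack := List ℕ × List (List ℕ)

namespace Stack

open StackChar

/-- The unary encoding of a list of natural numbers. -/
def encodeList (v : List ℕ) : List StackChar := v.flatMap fun n => List.replicate n one ++ [com]

/-- The encoding of a stack of lists. -/
def encodeRest (R : List (List ℕ)) : List StackChar := R.flatMap fun v => encodeList v ++ [sem]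

/-- The encoding of a nonempty stack of lists. -/
def encode (S : Stack) : List StackChar := encodeList S.1 ++ sem :: encodeRest S.2

@[simp] theorem encodeList_nil : encodeList [] = [] := rfl

theorem encodeList_cons (n : ℕ) (v : List ℕ) :
    encodeList (n :: v) = List.replicate n one ++ com :: encodeList v := by
  simp [encodeList]

@[simp] theorem encodeList_zero_cons (v : List ℕ) :
    encodeList (0 :: v) = com :: encodeList v := by
  simp [encodeList]

@[simp] theorem encodeList_succ_cons (n : ℕ) (v : List ℕ) :
    encodeList ((n + 1) :: v) = one :: encodeList (n :: v) := by
  simp [encodeList, List.replicate_succ]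

@[simp] theorem encodeRest_nil : encodeRest [] = [] := rfl

@[simp] theorem encodeRest_cons (v : List ℕ) (R : List (List ℕ)) :
    encodeRest (v :: R) = encodeList v ++ sem :: encodeRest R := by
  simp [encodeRest]

theorem ne_sem_of_mem_encodeList {v : List ℕ} : ∀ c ∈ encodeList v, c ≠ sem := by
  intro c hc
  obtain ⟨n, _, h⟩ := List.mem_flatMap.1 hc
  rcases List.mem_append.1 h with h | h
  · rw [List.eq_of_mem_replicate h]
    simp
  · rw [List.mem_singleton.1 h]
    simp

theorem encode_cons (n : ℕ) (v : List ℕ) (R : List (List ℕ)) : encode (n :: v, R) =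
    List.replicate n one ++ com :: (encodeList v ++ sem :: encodeRest R) := by
  simp [encode, encodeList_cons]

/-- The relation `r` on words acts as `T` on the encoding of the stack `S`. -/
def ActsAs (r : List StackChar → List StackChar → Prop) (T : Stack → Stack → Prop) (S : Stack) :
    Prop := ∀ d, r (encode S) d ↔ ∃ S', T S S' ∧ encode S' = d

/-- A relation on stacks that is the action of an implementable relation on their encodings. -/
def Realizable (T : Stack → Stack → Prop) : Prop :=
  ∃ r, Implementable r ∧ ∀ S, ActsAs r T S

namespace Realizable

variable {T U : Stack → Stack → Prop}

theorem congr (hT : Realizable T) (h : ∀ S S', T S S' ↔ U S S') : Realizable U := by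
  obtain rfl : T = U := by
    funext S S'
    exact propext (h S S')
  exact hT

/-- The word operation need only behave well on stacks that `T` can produce. This serves operations
that presuppose a nonempty top list, such as pushing `one`: in front of an empty list it does not
yield an encoding. -/
theorem comp_of_actsAs (hT : Realizable T) {r : List StackChar → List StackChar → Prop}
    (hr : Implementable r) (h : ∀ S S', T S S' → ActsAs r U S') : Realizable (Comp T U) := by
  obtain ⟨q, hq, hqT⟩ := hT
  refine ⟨_, hq.comp hr, fun S d => ?_⟩
  constructor
  · rintro ⟨d', h1, h2⟩
    obtain ⟨S', h3, rfl⟩ := (hqT S d').1 h1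
    obtain ⟨S'', h4, rfl⟩ := (h S S' h3 d).1 h2
    exact ⟨S'', ⟨S', h3, h4⟩, rfl⟩
  · rintro ⟨S'', ⟨S', h3, h4⟩, rfl⟩
    exact ⟨_, (hqT S _).2 ⟨S', h3, rfl⟩, (h S S' h3 _).2 ⟨S'', h4, rfl⟩⟩

theorem comp (hT : Realizable T) (hU : Realizable U) : Realizable (Comp T U) := by
  obtain ⟨r, hr, h⟩ := hU
  exact hT.comp_of_actsAs hr fun _ S' _ => h S'

theorem or (hT : Realizable T) (hU : Realizable U) : Realizable fun S S' => T S S' ∨ U S S' := by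
  obtain ⟨q, hq, hT⟩ := hT
  obtain ⟨r, hr, hU⟩ := hU
  refine ⟨_, hq.or hr, fun S d => ?_⟩
  rw [hT S d, hU S d, ← exists_or]
  exact exists_congr fun _ => or_and_right.symm

theorem reflTransGen (hT : Realizable T) : Realizable (ReflTransGen T) := by
  obtain ⟨r, hr, h⟩ := hT
  refine ⟨_, hr.reflTransGen, fun S d => ?_⟩
  constructor
  · intro hd
    induction hd with
    | refl => exact ⟨S, .refl, rfl⟩
    | tail _ hd ih =>
      obtain ⟨S', h1, rfl⟩ := ih
      obtain ⟨S'', h2, rfl⟩ := (h _ _).1 hd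
      exact ⟨S'', h1.tail h2, rfl⟩
  · rintro ⟨S', hS, rfl⟩
    exact hS.lift encode fun S S' hS => (h _ _).2 ⟨S', hS, rfl⟩

theorem dup : Realizable fun S S' => S' = (S.1, S.1 :: S.2) := by
  refine ⟨_, .dup, fun ⟨v, R⟩ d => ?_⟩
  constructor
  · rintro ⟨x, y, hx, h, rfl⟩
    obtain ⟨rfl, rfl⟩ := List.append_cons_inj_of_forall_ne ne_sem_of_mem_encodeList hx h
    exact ⟨_, rfl, by simp [encode]⟩
  · rintro ⟨_, rfl, rfl⟩
    exact ⟨encodeList v, encodeRest R, ne_sem_of_mem_encodeList, rfl, by simp [encode]⟩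

theorem swap : Realizable fun S S' => ∃ v w R, S = (v, w :: R) ∧ S' = (w, v :: R) := by
  refine ⟨_, .swap, fun ⟨v, R⟩ d => ?_⟩
  constructor
  · rintro ⟨x, y, z, hx, hy, h, rfl⟩
    obtain ⟨rfl, h'⟩ := List.append_cons_inj_of_forall_ne ne_sem_of_mem_encodeList hx h
    cases R with
    | nil => simp at h'
    | cons w R =>
      dsimp only at h'
      rw [encodeRest_cons] at h'
      obtain ⟨rfl, rfl⟩ := List.append_cons_inj_of_forall_ne ne_sem_of_mem_encodeList hy h'
      exact ⟨_, ⟨v, w, R, rfl, rfl⟩, by simp [encode]⟩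
  · rintro ⟨_, ⟨v, w, R, h, rfl⟩, rfl⟩
    rw [h]
    exact ⟨encodeList v, encodeList w, encodeRest R, ne_sem_of_mem_encodeList,
      ne_sem_of_mem_encodeList, by simp [encode], by simp [encode]⟩

theorem new : Realizable fun S S' => S' = ([], S.1 :: S.2) := by
  refine ⟨_, .push sem, fun ⟨v, R⟩ d => ?_⟩
  simp [encode, eq_comm]

theorem pushZero : Realizable fun S S' => S' = (0 :: S.1, S.2) := by
  refine ⟨_, .push com, fun ⟨v, R⟩ d => ?_⟩
  simp [encode, eq_comm]

theorem popZero : Realizable fun S S' => S = (0 :: S'.1, S'.2) := by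
  refine ⟨_, .pop com, fun ⟨v, R⟩ d => ?_⟩
  rcases v with _ | ⟨_ | n, v⟩ <;> simp [encode]

theorem decr : Realizable fun S S' => ∃ n v R, S = ((n + 1) :: v, R) ∧ S' = (n :: v, R) := by
  refine ⟨_, .pop one, fun ⟨v, R⟩ d => ?_⟩
  rcases v with _ | ⟨_ | n, v⟩ <;> simp [encode]

/-- Replacement of an empty list on top by the list with one entry zero. -/
theorem normalize : Realizable fun S S' => S' = (S.1.headI :: S.1.tail, S.2) := by
  -- The first character of the encoding decides: `sem` means an empty top list, which receives an
  -- entry zero; in the other two cases a character is popped and put back.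
  refine ⟨_, (((Implementable.pop sem).comp (.push sem)).comp (.push com)).or
    (((Implementable.pop one).comp (.push one)).or ((Implementable.pop com).comp (.push com))),
    fun ⟨v, R⟩ d => ?_⟩
  rcases v with _ | ⟨_ | n, v⟩ <;> simp [encode, Comp, eq_comm]

theorem incr : Realizable fun S S' => S' = ((S.1.headI + 1) :: S.1.tail, S.2) := by
  refine (normalize.comp_of_actsAs (.push one)
    (U := fun S S' => S' = ((S.1.headI + 1) :: S.1.tail, S.2)) ?_).congr ?_
  · rintro ⟨v, R⟩ _ rfl d
    simp [encode, eq_comm]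
  · rintro ⟨v, R⟩ S'
    simp [Comp]

/-- The head of the second list is put in front of the topmost list. -/
theorem combine :
    Realizable fun S S' => ∃ v w R, S = (v, w :: R) ∧ S' = (w.headI :: v, R) := by
  -- After the exchange, `cut` deletes the tail of the topmost list together with its separator
  -- `sem`, so the remaining head is fused with the list below. Normalization supplies the head
  -- zero, the value of `headI` on an empty list.
  refine ((swap.comp normalize).comp_of_actsAs .cut
    (U := fun S S' => ∃ n v w R, S = (n :: w, v :: R) ∧ S' = (n :: v, R)) ?_).congr ?_
  · rintro S _ ⟨_, ⟨v, w, R, rfl, rfl⟩, rfl⟩ d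
    constructor
    · rintro ⟨x, y, z, hx, hy, h, rfl⟩
      rw [encode_cons] at h
      obtain ⟨rfl, h'⟩ := List.append_cons_inj_of_forall_ne (s := com)
        (fun c hc => by simp [List.eq_of_mem_replicate hc]) (fun c hc => by simp [hx c hc]) h
      obtain ⟨rfl, rfl⟩ := List.append_cons_inj_of_forall_ne ne_sem_of_mem_encodeList hy h'
      exact ⟨_, ⟨_, _, _, _, rfl, rfl⟩, by simp [encode_cons]⟩
    · rintro ⟨_, ⟨n, v, w, R, h, rfl⟩, rfl⟩
      rw [h]
      exact ⟨List.replicate n one, encodeList w, encodeRest (v :: R),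
        fun c hc => List.eq_of_mem_replicate hc, ne_sem_of_mem_encodeList, by simp [encode_cons],
        by simp [encode_cons]⟩
  · intro S S'
    constructor
    · rintro ⟨_, ⟨_, ⟨v, w, R, rfl, rfl⟩, rfl⟩, n, v', w', R', h, rfl⟩
      simp only [Prod.mk.injEq, List.cons.injEq] at h
      obtain ⟨⟨rfl, -⟩, rfl, rfl⟩ := h
      exact ⟨_, _, _, rfl, rfl⟩
    · rintro ⟨v, w, R, rfl, rfl⟩
      exact ⟨_, ⟨_, ⟨v, w, R, rfl, rfl⟩, rfl⟩, _, _, _, _, rfl, rfl⟩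

end Realizable

/-! ### Partial recursive functions as stack relations. -/

/-- A partial function on lists, as a relation on stacks: it is applied to the topmost list. -/
def onTop (f : List ℕ →. List ℕ) (S S' : Stack) : Prop := ∃ w ∈ f S.1, S' = (w, S.2)

namespace Realizable

theorem tail : Realizable fun S S' => S' = (S.1.tail, S.2) := by
  -- The number of decrements is guessed, and `popZero` succeeds only when the head has reached
  -- zero.
  refine ((normalize.comp decr.reflTransGen).comp popZero).congr fun S S' => ?_
  constructor
  · rintro ⟨_, ⟨_, rfl, h⟩, h'⟩
    have key : ∀ S S' : Stack, ReflTransGen (fun S S' : Stack =>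
        ∃ n v R, S = ((n + 1) :: v, R) ∧ S' = (n :: v, R)) S S' →
        (S'.1.tail, S'.2) = (S.1.tail, S.2) := by
      intro S S' h
      induction h with
      | refl => rfl
      | tail _ h ih =>
        obtain ⟨n, v, R, rfl, rfl⟩ := h
        exact ih
    have := key _ _ h
    rw [h'] at this
    exact this
  · rintro rfl
    refine ⟨(0 :: S.1.tail, S.2), ⟨_, rfl, ?_⟩, rfl⟩
    induction S.1.headI with
    | zero => exact .refl
    | succ n ih => exact .head ⟨_, _, _, rfl, rfl⟩ ih

theorem onTop_comp {f g : List ℕ →. List ℕ} (hf : Realizable (onTop f))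
    (hg : Realizable (onTop g)) : Realizable (onTop fun v => g v >>= f) := by
  refine (hg.comp hf).congr fun S S' => ?_
  constructor
  · rintro ⟨_, ⟨w, hw, rfl⟩, x, hx, rfl⟩
    exact ⟨x, Part.mem_bind_iff.2 ⟨w, hw, hx⟩, rfl⟩
  · rintro ⟨x, hx, rfl⟩
    obtain ⟨w, hw, hx⟩ := Part.mem_bind_iff.1 hx
    exact ⟨_, ⟨w, hw, rfl⟩, x, hx, rfl⟩

theorem onTop_cons {f g : List ℕ →. List ℕ} (hf : Realizable (onTop f))
    (hg : Realizable (onTop g)) : Realizable (onTop fun v => do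
      let n ← f v
      let ns ← g v
      pure (n.headI :: ns)) := by
  -- The argument is saved by duplication: `f` consumes one copy, its result is parked below the
  -- other copy while `g` runs, and only the head of that result is kept.
  refine ((((dup.comp hf).comp swap).comp hg).comp combine).congr fun S S' => ?_
  constructor
  · rintro ⟨_, ⟨_, ⟨_, ⟨_, rfl, w, hw, rfl⟩, v, w', R, h, rfl⟩, x, hx, rfl⟩, v', w'', R', h', rfl⟩
    simp only [Prod.mk.injEq, List.cons.injEq] at h h'
    obtain ⟨rfl, rfl, rfl⟩ := h
    obtain ⟨rfl, rfl, rfl⟩ := h'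
    exact ⟨_, Part.mem_bind_iff.2 ⟨w, hw, Part.mem_bind_iff.2 ⟨x, hx, Part.mem_some _⟩⟩, rfl⟩
  · rintro ⟨_, h, rfl⟩
    obtain ⟨w, hw, h⟩ := Part.mem_bind_iff.1 h
    obtain ⟨x, hx, h⟩ := Part.mem_bind_iff.1 h
    obtain rfl := Part.mem_some_iff.1 h
    exact ⟨_, ⟨_, ⟨_, ⟨_, rfl, w, hw, rfl⟩, _, _, _, rfl, rfl⟩, x, hx, rfl⟩, _, _, _, rfl, rfl⟩

theorem onTop_case {f g : List ℕ →. List ℕ} (hf : Realizable (onTop f))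
    (hg : Realizable (onTop g)) :
    Realizable (onTop fun v => v.headI.rec (f v.tail) fun y _ => g (y :: v.tail)) := by
  refine (normalize.comp ((popZero.comp hf).or (decr.comp hg))).congr fun S S' => ?_
  have key : ∀ k, S.1.headI = k → ∀ w, w ∈ (Nat.rec (f S.1.tail) (fun y _ => g (y :: S.1.tail))
      S.1.headI : Part (List ℕ)) ↔
      w ∈ (Nat.rec (f S.1.tail) (fun y _ => g (y :: S.1.tail)) k : Part (List ℕ)) := by
    rintro _ rfl w
    rfl
  constructor
  · rintro ⟨_, rfl, ⟨⟨v, R⟩, h, w, hw, rfl⟩ | ⟨_, ⟨n, v, R, h, rfl⟩, w, hw, rfl⟩⟩ <;>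
    · simp only [Prod.mk.injEq, List.cons.injEq] at h
      obtain ⟨⟨h1, rfl⟩, rfl⟩ := h
      exact ⟨w, (key _ h1 w).2 hw, rfl⟩
  · rintro ⟨w, hw, rfl⟩
    refine ⟨_, rfl, ?_⟩
    cases h : S.1.headI with
    | zero => exact Or.inl ⟨(_, _), rfl, w, (key _ h w).1 hw, rfl⟩
    | succ n => exact Or.inr ⟨_, ⟨_, _, _, rfl, rfl⟩, w, (key _ h w).1 hw, rfl⟩

theorem onTop_fix {f : List ℕ →. List ℕ} (hf : Realizable (onTop f)) :
    Realizable (onTop (PFun.fix fun v =>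
      (f v).map fun v => if v.headI = 0 then Sum.inl v.tail else Sum.inr v.tail)) := by
  set F : List ℕ →. List ℕ ⊕ List ℕ := fun v =>
    (f v).map fun v => if v.headI = 0 then Sum.inl v.tail else Sum.inr v.tail
  -- The exit step `hl` can pass only a zero flag and the loop step `hr` only a nonzero one, so
  -- guessing the number of iterations is harmless.
  have hl : Realizable fun S S' => ∃ w, Sum.inl w ∈ F S.1 ∧ S' = (w, S.2) := by
    refine ((hf.comp normalize).comp popZero).congr fun S S' => ?_
    constructor
    · rintro ⟨_, ⟨_, ⟨w, hw, rfl⟩, rfl⟩, h⟩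
      simp only [Prod.mk.injEq, List.cons.injEq] at h
      exact ⟨w.tail, (Part.mem_map_iff _).2 ⟨w, hw, if_pos h.1.1⟩, Prod.ext h.1.2.symm h.2.symm⟩
    · rintro ⟨_, h, rfl⟩
      obtain ⟨w, hw, h⟩ := (Part.mem_map_iff _).1 h
      split_ifs at h with h0
      obtain rfl := Sum.inl.inj h
      exact ⟨_, ⟨_, ⟨w, hw, rfl⟩, rfl⟩, by rw [h0]⟩
  have hr : Realizable fun S S' => ∃ w, Sum.inr w ∈ F S.1 ∧ S' = (w, S.2) := by
    refine (((hf.comp normalize).comp decr).comp tail).congr fun S S' => ?_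
    constructor
    · rintro ⟨_, ⟨_, ⟨_, ⟨w, hw, rfl⟩, rfl⟩, n, v, R, h, rfl⟩, rfl⟩
      simp only [Prod.mk.injEq, List.cons.injEq] at h
      obtain ⟨⟨h1, rfl⟩, rfl⟩ := h
      exact ⟨w.tail, (Part.mem_map_iff _).2 ⟨w, hw, if_neg (by simp [h1])⟩, rfl⟩
    · rintro ⟨_, h, rfl⟩
      obtain ⟨w, hw, h⟩ := (Part.mem_map_iff _).1 h
      split_ifs at h with h0
      obtain rfl := Sum.inr.inj h
      obtain ⟨n, hn⟩ := Nat.exists_eq_succ_of_ne_zero h0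
      exact ⟨_, ⟨_, ⟨_, ⟨w, hw, rfl⟩, rfl⟩, n, w.tail, S.2, by rw [hn], rfl⟩, rfl⟩
  refine (hr.reflTransGen.comp hl).congr fun S S' => ?_
  constructor
  · rintro ⟨S₁, h, w, hw, rfl⟩
    induction h using ReflTransGen.head_induction_on with
    | refl => exact ⟨w, PFun.mem_fix_iff.2 (Or.inl hw), rfl⟩
    | head h _ ih =>
      obtain ⟨v, hv, rfl⟩ := h
      obtain ⟨x, hx, h⟩ := ih
      exact ⟨x, PFun.mem_fix_iff.2 (Or.inr ⟨v, hv, hx⟩), h⟩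
  · rintro ⟨w, hw, rfl⟩
    obtain ⟨v, R⟩ := S
    change w ∈ PFun.fix F v at hw
    refine PFun.fixInduction' (C := fun v => Comp (ReflTransGen _) _ (v, R) (w, R)) hw
      (fun v h => ⟨_, .refl, w, h, rfl⟩) ?_
    rintro v v' _ h ⟨S₁, h1, w', hw', h2⟩
    exact ⟨S₁, .head ⟨v', h, rfl⟩ h1, w', hw', h2⟩

/-- Every partial recursive function on lists is realizable. -/
theorem onTop_eval (c : Turing.ToPartrec.Code) : Realizable (onTop c.eval) := by
  induction c with
  | zero' =>
    rw [Turing.ToPartrec.Code.zero'_eval]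
    exact pushZero.congr fun S S' => by simp [onTop]
  | succ =>
    rw [Turing.ToPartrec.Code.succ_eval]
    refine ((new.comp combine).comp incr).congr fun S S' => ?_
    simp [onTop, Comp]
  | tail =>
    rw [Turing.ToPartrec.Code.tail_eval]
    exact tail.congr fun S S' => by simp [onTop]
  | cons f g hf hg =>
    rw [Turing.ToPartrec.Code.cons_eval]
    exact onTop_cons hf hg
  | comp f g hf hg =>
    rw [Turing.ToPartrec.Code.comp_eval]
    exact onTop_comp hf hg
  | case f g hf hg =>
    rw [Turing.ToPartrec.Code.case_eval]
    exact onTop_case hf hg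
  | fix f hf =>
    rw [Turing.ToPartrec.Code.fix_eval]
    exact onTop_fix hf

end Realizable

end Stack

/-! ### From halting computations to shuffles. -/

open TraceLetter

/-- The halting inputs of a fixed program, as the numbers of occurrences of the letter `digit` in
the consistent traces of a regular language. -/
theorem exists_isRegular_trace (c : Turing.ToPartrec.Code) :
    ∃ R : Language TraceLetter, R.IsRegular ∧ ∀ n, (c.eval [n]).Dom ↔
      ∃ u ∈ R, u.count digit = n ∧ u.filterMap inp = u.filterMap out ∧
        u.filterMap cmpA = u.filterMap cmpB := by
  obtain ⟨r, ⟨X, hX⟩, hr⟩ := Stack.Realizable.onTop_eval c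
  -- Behind `n` digits, `pre` completes the encoding of the stack `([n], [])` and its end mark on
  -- the output track alone, which gives that track its lead of one round. The closing segment and
  -- `post` read the final word without writing.
  let pre : List TraceLetter := tag (false, true, false, false) [.com, .sem] ++
    [((false, true, false, false), none)]
  let post : List TraceLetter := [((true, false, false, false), none)]
  refine ⟨Language.lettersIn (· = digit) * ({pre} * (X *
    (segment (true, false, false, false) (fun _ => True) * {post}))),
    (Language.isRegular_lettersIn _).mul ((Language.isRegular_singleton_word _).mul
      (hX.isRegular.mul ((isRegular_segment _ _).mul (Language.isRegular_singleton_word _)))),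
    fun n => ?_⟩
  -- The comparison flags of `digit` give it a combination used nowhere else in a trace, so it can
  -- be counted; set on both tracks, they leave the comparison unaffected.
  have hdigit : ∀ m, (List.replicate m digit).filterMap out =
      (List.replicate m StackChar.one).map some ∧
      (List.replicate m digit).filterMap inp = [] ∧
      (List.replicate m digit).filterMap cmpA = (List.replicate m digit).filterMap cmpB := by
    intro m
    simp only [List.map_replicate]
    induction m with
    | zero => simp
    | succ m ih =>
      simp only [List.replicate_succ, List.filterMap_cons, ih]
      simp [digit, out, inp, cmpA, cmpB]
  have hcount : ∀ m, ∀ u ∈ X, ∀ d : List StackChar, (List.replicate m digit ++ (pre ++ (u ++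
      (tag (true, false, false, false) d ++ post)))).count digit = m := by
    intro m u hu d
    rw [List.count_append, List.count_replicate_self, List.count_eq_zero.2, Nat.add_zero]
    simp [pre, post, digit_notMem_tag, hX.digit_notMem u hu]
    simp [digit]
  have hencode : (Stack.encode ([n], [])).map some =
      (List.replicate n StackChar.one).map some ++ [some .com, some .sem] := by
    simp [Stack.encode, Stack.encodeList]
  constructor
  · intro h
    obtain ⟨w, hw⟩ := Part.dom_iff_mem.1 h
    obtain ⟨u, hu, h1, h2⟩ := hX.complete _ _ ((hr ([n], []) _).2 ⟨_, ⟨w, hw, rfl⟩, rfl⟩)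
    refine ⟨List.replicate n digit ++ (pre ++ (u ++ (tag (true, false, false, false)
      (Stack.encode (w, [])) ++ post))),
      Language.append_mem_mul (fun _ h => List.eq_of_mem_replicate h)
        (Language.append_mem_mul rfl (Language.append_mem_mul hu (Language.append_mem_mul
          (mem_segment.2 ⟨_, by simp, rfl⟩) rfl))), hcount n u hu _, ?_, ?_⟩
    · rw [hencode] at h1
      simpa [hdigit, pre, post, inp, out, List.filterMap_cons] using h1.symm
    · simp [hdigit, pre, post, cmpA, cmpB, h2, List.filterMap_cons]
  · rintro ⟨_, ⟨v, hv, _, ⟨_, rfl, _, ⟨u, hu, _, ⟨_, hd, _, rfl, rfl⟩, rfl⟩, rfl⟩, rfl⟩, hn, h1, h2⟩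
    obtain ⟨m, rfl⟩ : ∃ m, v = List.replicate m digit :=
      ⟨v.length, List.eq_replicate_of_mem hv⟩
    obtain ⟨d, -, rfl⟩ := mem_segment.1 hd
    obtain rfl : m = n := by rw [← hn, hcount m u hu d]
    have h3 : (Stack.encode ([m], [])).map some ++ none :: (u.filterMap out ++ []) =
        u.filterMap inp ++ (d.map some ++ [none]) := by
      rw [hencode]
      simpa [hdigit, pre, post, inp, out, List.filterMap_cons] using h1.symm
    have h4 : u.filterMap cmpA ++ [] = u.filterMap cmpB ++ [] := by
      simpa [hdigit, pre, post, cmpA, cmpB, List.filterMap_cons] using h2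
    obtain ⟨d', hd', -⟩ := hX.sound u hu _ _ _ _ _ h3 h4
    obtain ⟨_, ⟨w, hw, -⟩, -⟩ := (hr _ _).1 hd'
    exact Part.dom_iff_mem.2 ⟨w, hw⟩

/-- The halting inputs of a fixed program, as the numbers of occurrences of the letter `digit` in
the first words of pairs none of whose interleavings belongs to a fixed regular language. -/
theorem exists_isRegular_forall_notMem (c : Turing.ToPartrec.Code) :
    ∃ L : Language (TraceLetter ⊕ TraceLetter), L.IsRegular ∧ ∀ n, (c.eval [n]).Dom ↔
      ∃ u v : List TraceLetter, u.count digit = n ∧ ∀ w, w.filterMap Sum.getLeft? = u →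
        w.filterMap Sum.getRight? = v → w ∉ L := by
  obtain ⟨R, hR, h⟩ := exists_isRegular_trace c
  -- One summand for each way to fail: `u` is no trace, the input and output tracks differ, the
  -- comparison tracks differ, or `u ≠ v`. The last lets the mixed equations between `u` and `v` be
  -- read as equations on `u` alone.
  refine ⟨Language.filterMapPreimage Sum.getLeft? Rᶜ + mismatch inp out +
    mismatch cmpA cmpB + mismatch some some, (((hR.compl.filterMapPreimage _).add
      (isRegular_mismatch _ _)).add (isRegular_mismatch _ _)).add (isRegular_mismatch _ _),
    fun n => ?_⟩
  rw [h n]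
  constructor
  · rintro ⟨u, hu, hn, h1, h2⟩
    refine ⟨u, u, hn, ?_⟩
    rintro w hl hr (((hw | hw) | hw) | hw)
    · rw [← hl] at hu
      exact hw hu
    · exact (exists_mem_mismatch_iff _ _ u u).1 ⟨w, hw, hl, hr⟩ h1
    · exact (exists_mem_mismatch_iff _ _ u u).1 ⟨w, hw, hl, hr⟩ h2
    · exact (exists_mem_mismatch_iff _ _ u u).1 ⟨w, hw, hl, hr⟩ rfl
  · rintro ⟨u, v, hn, hw⟩
    have eq {f g : TraceLetter → Option (Option StackChar)}
        (hfg : ∀ w ∈ mismatch f g, w.filterMap Sum.getLeft? = u → w.filterMap Sum.getRight? ≠ v) :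
        u.filterMap f = v.filterMap g := by
      by_contra hne
      obtain ⟨w, h, hl, hr⟩ := (exists_mem_mismatch_iff f g u v).2 hne
      exact hfg w h hl hr
    obtain rfl : u = v := by
      by_contra hne
      obtain ⟨w, h, hl, hr⟩ := (exists_mem_mismatch_iff some some u v).2 (by simpa using hne)
      exact hw w hl hr (Or.inr h)
    refine ⟨u, ?_, hn, eq fun w h hl hr => hw w hl hr (Or.inl (Or.inl (Or.inr h))),
      eq fun w h hl hr => hw w hl hr (Or.inl (Or.inr h))⟩
    by_contra hu
    have hl := List.filterMap_getLeft?_map_append u u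
    refine hw _ hl (List.filterMap_getRight?_map_append u u) (Or.inl (Or.inl (Or.inl ?_)))
    refine Language.mem_filterMapPreimage.2 ?_
    rw [hl]
    exact hu

/-! ### Adjoining a letter counter to an automaton, computably. -/

namespace AutomatonCode

/-- The letters of two alphabets with `k` and `m` letters. -/
def letters (k m : ℕ) : List (ℕ ⊕ ℕ) := (List.range k).map Sum.inl ++ (List.range m).map Sum.inr

/-- Disjointly to the automaton `A`, an automaton that accepts the words in which the number of
occurrences of the letter `a` is not `n`. -/
def addCount (A : AutomatonCode) (k m : ℕ) (a : ℕ ⊕ ℕ) (n : ℕ) : AutomatonCode where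
  -- The counter state `A.states + i` stands for exactly `i` occurrences if `i ≤ n`, and for more
  -- than `n` if `i = n + 1`.
  states := A.states + (n + 2)
  -- A code may mention state numbers out of range. They are inert in `A` but would become counter
  -- states here, so they are filtered out, likewise below.
  trans := A.trans.filter (fun t => t.1 < A.states ∧ t.2.2 < A.states) ++
    (List.range (n + 2)).flatMap fun i => (letters k m).map fun x =>
      (A.states + i, x, A.states + if x = a then min (i + 1) (n + 1) else i)
  start := A.states :: A.start.filter (· < A.states)
  accept := A.accept.filter (· < A.states) ++
    (List.range n ++ [n + 1]).map (A.states + ·)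

/-- Only `n` varies: the data of `A` enter as constants, so it does not matter that `A` is obtained
nonconstructively. -/
theorem computable_addCount (A : AutomatonCode) (k m : ℕ) (a : ℕ ⊕ ℕ) :
    Computable (A.addCount k m a) := by
  have h : Primrec fun n => (A.addCount k m a n).equivTuple := by
    have hs (n : ℕ) : Primrec fun i : ℕ => n + i := Primrec.nat_add.comp (.const n) .id
    refine Primrec.pair ((hs _).comp (Primrec.nat_add.comp .id (.const 2))) (Primrec.pair
      ?_ (Primrec.pair (.const _) ?_))
    · refine Primrec.list_append.comp (.const _) (Primrec.list_flatMap
        (Primrec.list_range.comp (Primrec.nat_add.comp .id (.const 2))) ?_)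
      refine Primrec.list_map (.const _) ?_
      refine Primrec.pair ((hs _).comp (Primrec.snd.comp .fst)) (Primrec.pair .snd
        ((hs _).comp (Primrec.ite (Primrec.eq.comp .snd (.const a)) ?_
          (Primrec.snd.comp .fst))))
      exact Primrec.nat_min.comp (Primrec.succ.comp (Primrec.snd.comp .fst))
        (Primrec.succ.comp (Primrec.fst.comp .fst))
    · refine Primrec.list_append.comp (.const _) (Primrec.list_map ?_ ((hs _).comp .snd))
      exact Primrec.list_append.comp Primrec.list_range
        (Primrec.list_cons.comp Primrec.succ (.const []))
  have h' : Primrec AutomatonCode.equivTuple.symm := Primrec.of_equiv_symm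
  exact ((h'.comp h).of_eq fun n => rfl).to_comp

variable (A : AutomatonCode) {k m : ℕ} (a : Fin k ⊕ Fin m) (n : ℕ)

theorem mem_letters (x : Fin k ⊕ Fin m) : Sum.map Fin.val Fin.val x ∈ letters k m := by
  cases x <;> simp [letters]

theorem addCount_states (k m : ℕ) (a : ℕ ⊕ ℕ) (n : ℕ) :
    (A.addCount k m a n).states = A.states + (n + 2) := rfl

theorem mem_addCount_step
    (s t : Fin (A.addCount k m (Sum.map Fin.val Fin.val a) n).states) (x : Fin k ⊕ Fin m) :
    t ∈ ((A.addCount k m (Sum.map Fin.val Fin.val a) n).toNFA k m).step s x ↔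
      (∃ s' t' : Fin A.states, s'.val = s.val ∧ t'.val = t.val ∧ t' ∈ (A.toNFA k m).step s' x) ∨
      ∃ i < n + 2, s.val = A.states + i ∧
        t.val = A.states + if x = a then min (i + 1) (n + 1) else i := by
  have inj : Function.Injective (Sum.map Fin.val Fin.val : Fin k ⊕ Fin m → ℕ ⊕ ℕ) :=
    Sum.map_injective.2 ⟨Fin.val_injective, Fin.val_injective⟩
  change (s.val, Sum.map Fin.val Fin.val x, t.val) ∈
    A.trans.filter _ ++ (List.range (n + 2)).flatMap _ ↔ _
  rw [List.mem_append]
  refine or_congr ?_ ?_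
  · rw [List.mem_filter]
    constructor
    · rintro ⟨h, h'⟩
      obtain ⟨h1, h2⟩ := of_decide_eq_true h'
      exact ⟨⟨s, h1⟩, ⟨t, h2⟩, rfl, rfl, h⟩
    · rintro ⟨s', t', hs, ht, h⟩
      rw [← hs, ← ht]
      exact ⟨h, decide_eq_true ⟨s'.2, t'.2⟩⟩
  · simp only [List.mem_flatMap, List.mem_range, List.mem_map, Prod.mk.injEq]
    constructor
    · rintro ⟨i, hi, y, _, hs, rfl, ht⟩
      refine ⟨i, hi, hs.symm, ?_⟩
      rw [← ht]
      simp only [inj.eq_iff]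
    · rintro ⟨i, hi, hs, ht⟩
      refine ⟨i, hi, _, mem_letters x, hs.symm, rfl, ?_⟩
      rw [ht]
      simp only [inj.eq_iff]

/-- No transition joins the old states to the counter states, so the two parts run independently,
and the counter is deterministic. -/
theorem mem_addCount_eval (w : List (Fin k ⊕ Fin m))
    (t : Fin (A.addCount k m (Sum.map Fin.val Fin.val a) n).states) :
    t ∈ ((A.addCount k m (Sum.map Fin.val Fin.val a) n).toNFA k m).eval w ↔
      (∃ t' : Fin A.states, t'.val = t.val ∧ t' ∈ (A.toNFA k m).eval w) ∨
      t.val = A.states + min (w.countP (· = a)) (n + 1) := by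
  induction w using List.reverseRecOn generalizing t with
  | nil =>
    change t.val ∈ A.states :: A.start.filter (· < A.states) ↔ _
    rw [List.mem_cons, or_comm, List.mem_filter]
    refine or_congr ?_ (by simp)
    constructor
    · rintro ⟨h, h'⟩
      exact ⟨⟨t, of_decide_eq_true h'⟩, rfl, h⟩
    · rintro ⟨t', ht, h⟩
      rw [← ht]
      exact ⟨h, decide_eq_true t'.2⟩
  | append_singleton w x ih =>
    rw [NFA.eval_append_singleton, NFA.eval_append_singleton, NFA.mem_stepSet]
    have hcount : (if x = a then min (min (w.countP (· = a)) (n + 1) + 1) (n + 1)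
        else min (w.countP (· = a)) (n + 1)) = min ((w ++ [x]).countP (· = a)) (n + 1) := by
      rw [List.countP_append, List.countP_singleton]
      by_cases hx : x = a
      · simp [hx]
      · simp [hx]
    constructor
    · rintro ⟨s, hs, ht⟩
      rw [ih] at hs
      rw [mem_addCount_step] at ht
      rcases hs with ⟨s', hs', hs⟩ | hs
      · rcases ht with ⟨s'', t', hs'', ht', ht⟩ | ⟨i, _, h, _⟩
        · obtain rfl : s'' = s' := Fin.ext (hs''.trans hs'.symm)
          exact Or.inl ⟨t', ht', NFA.mem_stepSet.2 ⟨s'', hs, ht⟩⟩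
        · have := s'.2
          omega
      · rcases ht with ⟨s'', t', hs'', ht', ht⟩ | ⟨i, _, h, ht⟩
        · have := s''.2
          omega
        · obtain rfl : i = min (w.countP (· = a)) (n + 1) := by omega
          rw [hcount] at ht
          exact Or.inr ht
    · rintro (⟨t', ht', ht⟩ | ht)
      · obtain ⟨s', hs', h⟩ := NFA.mem_stepSet.1 ht
        exact ⟨⟨s', by have := s'.2; rw [addCount_states]; omega⟩, (ih _).2 (Or.inl ⟨s', rfl, hs'⟩),
          (mem_addCount_step ..).2 (Or.inl ⟨s', t', rfl, ht', h⟩)⟩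
      · refine ⟨⟨A.states + min (w.countP (· = a)) (n + 1), by rw [addCount_states]; omega⟩,
          (ih _).2 (Or.inr rfl),
          (mem_addCount_step ..).2 (Or.inr ⟨_, by omega, rfl, ?_⟩)⟩
        rw [hcount, ht]

theorem mem_addCount_language (w : List (Fin k ⊕ Fin m)) :
    w ∈ (A.addCount k m (Sum.map Fin.val Fin.val a) n).language k m ↔
      w ∈ A.language k m ∨ w.countP (· = a) ≠ n := by
  have accept (t : Fin (A.addCount k m (Sum.map Fin.val Fin.val a) n).states) :
      t ∈ ((A.addCount k m (Sum.map Fin.val Fin.val a) n).toNFA k m).accept ↔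
        (∃ t' : Fin A.states, t'.val = t.val ∧ t' ∈ (A.toNFA k m).accept) ∨
          ∃ i < n + 2, i ≠ n ∧ t.val = A.states + i := by
    change t.val ∈ A.accept.filter _ ++ (List.range n ++ [n + 1]).map _ ↔ _
    rw [List.mem_append]
    refine or_congr ?_ ?_
    · rw [List.mem_filter]
      constructor
      · rintro ⟨h, h'⟩
        exact ⟨⟨t, of_decide_eq_true h'⟩, rfl, h⟩
      · rintro ⟨t', ht, h⟩
        rw [← ht]
        exact ⟨h, decide_eq_true t'.2⟩
    · simp only [List.mem_map, List.mem_append, List.mem_range, List.mem_singleton]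
      constructor
      · rintro ⟨i, hi, h⟩
        exact ⟨i, by omega, by omega, h.symm⟩
      · rintro ⟨i, hi, hn, h⟩
        exact ⟨i, by omega, h.symm⟩
  constructor
  · rintro ⟨t, ht, hw⟩
    rw [accept] at ht
    rw [mem_addCount_eval] at hw
    rcases hw with ⟨s, hs, hw⟩ | hw
    · rcases ht with ⟨t', ht', ht⟩ | ⟨i, _, _, h⟩
      · obtain rfl : s = t' := Fin.ext (hs.trans ht'.symm)
        exact Or.inl ⟨s, ht, hw⟩
      · have := s.2
        omega
    · rcases ht with ⟨t', ht', ht⟩ | ⟨i, _, _, h⟩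
      · have := t'.2
        omega
      · right
        omega
  · rintro (⟨t, ht, hw⟩ | h)
    · refine ⟨⟨t, by have := t.2; rw [addCount_states]; omega⟩, (accept _).2 (Or.inl ⟨t, rfl, ht⟩),
        (mem_addCount_eval ..).2 (Or.inl ⟨t, rfl, hw⟩)⟩
    · exact ⟨⟨A.states + min (w.countP (· = a)) (n + 1), by rw [addCount_states]; omega⟩,
        (accept _).2 (Or.inr ⟨_, by omega, by omega, rfl⟩), (mem_addCount_eval ..).2 (Or.inr rfl)⟩

end AutomatonCode

/-- The instances of the shuffling problem for a fixed automaton that is extended by a comparison of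
the number of occurrences of a letter with `n` express halting on the input `n`. -/
theorem exists_shufflingProblem_iff_dom (c : Turing.ToPartrec.Code) :
    ∃ (A : AutomatonCode) (k : ℕ) (a : ℕ ⊕ ℕ), ∀ n,
      ShufflingProblem (k, k, A.addCount k k a n) ↔ (c.eval [n]).Dom := by
  obtain ⟨L, hL, h⟩ := exists_isRegular_forall_notMem c
  let e : TraceLetter ≃ Fin (Fintype.card TraceLetter) := Fintype.equivFin _
  let g : Fin (Fintype.card TraceLetter) ⊕ Fin (Fintype.card TraceLetter) →
    TraceLetter ⊕ TraceLetter := Sum.map e.symm e.symm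
  obtain ⟨A, hA⟩ := (AutomatonCode.isRegular_iff_exists_language _).1
    (hL.filterMapPreimage fun x => some (g x))
  replace hA : ∀ w, w ∈ A.language _ _ ↔ w.map g ∈ L := by
    intro w
    rw [hA, ← List.filterMap_eq_map]
    rfl
  refine ⟨A, Fintype.card TraceLetter, Sum.map Fin.val Fin.val
    (Sum.inl (e digit) : Fin _ ⊕ Fin (Fintype.card TraceLetter)), fun n => ?_⟩
  rw [h n]
  have hcount (w : List (Fin (Fintype.card TraceLetter) ⊕ Fin (Fintype.card TraceLetter))) :
      w.countP (· = Sum.inl (e digit)) = ((w.map g).filterMap Sum.getLeft?).count digit := by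
    induction w with
    | nil => rfl
    | cons x w ih =>
      cases x with
      | inl x =>
        rw [List.countP_cons, List.map_cons]
        change _ = List.count digit (e.symm x :: _)
        rw [List.count_cons, ih]
        simp [Equiv.symm_apply_eq]
      | inr x =>
        rw [List.countP_cons, ih]
        simp [g, List.filterMap_cons]
  have hl (w : List (Fin (Fintype.card TraceLetter) ⊕ Fin (Fintype.card TraceLetter))) :
      (w.map g).filterMap Sum.getLeft? = (w.filterMap Sum.getLeft?).map e.symm := by
    induction w with
    | nil => rfl
    | cons x w ih => cases x <;> simp_all [g, List.filterMap_cons]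
  have hr (w : List (Fin (Fintype.card TraceLetter) ⊕ Fin (Fintype.card TraceLetter))) :
      (w.map g).filterMap Sum.getRight? = (w.filterMap Sum.getRight?).map e.symm := by
    induction w with
    | nil => rfl
    | cons x w ih => cases x <;> simp_all [g, List.filterMap_cons]
  have hinj : Function.Injective (List.map e.symm) := List.map_injective_iff.2 e.symm.injective
  have hsurj : Function.Surjective g := Sum.map_surjective.2 ⟨e.symm.surjective, e.symm.surjective⟩
  constructor
  · rintro ⟨u, v, huv⟩
    -- Avoiding the extended automaton means avoiding `L` and having count exactly `n`. The count
    -- depends only on the left projection, so it is a condition on `u`.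
    have key : ∀ w : List (Fin _ ⊕ Fin _), w.filterMap Sum.getLeft? = u →
        w.filterMap Sum.getRight? = v → w.map g ∉ L ∧ w.countP (· = Sum.inl (e digit)) = n := by
      intro w h1 h2
      have := Set.eq_empty_iff_forall_notMem.1 huv w
      rw [Set.mem_inter_iff, mem_shuffle_map_iff] at this
      have := fun hw => this ⟨⟨h1, h2⟩, (AutomatonCode.mem_addCount_language _ _ _ _).2 hw⟩
      rw [hA] at this
      exact ⟨fun hw => this (Or.inl hw), by_contra fun hw => this (Or.inr hw)⟩
    refine ⟨u.map e.symm, v.map e.symm, ?_, fun w h1 h2 => ?_⟩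
    · have h1 := List.filterMap_getLeft?_map_append u v
      rw [← (key _ h1 (List.filterMap_getRight?_map_append u v)).2, hcount, hl, h1]
    · obtain ⟨w, rfl⟩ := (List.map_surjective_iff.2 hsurj) w
      rw [hl] at h1
      rw [hr] at h2
      exact (key w (hinj h1) (hinj h2)).1
  · rintro ⟨u, v, hn, huv⟩
    have he (u : List TraceLetter) : (u.map e).map e.symm = u := by simp
    refine ⟨u.map e, v.map e, Set.eq_empty_iff_forall_notMem.2 ?_⟩
    rintro w ⟨hw, hw'⟩
    obtain ⟨h1, h2⟩ := (mem_shuffle_map_iff _ _ _).1 hw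
    have h1' := hl w
    have h2' := hr w
    rw [h1, he] at h1'
    rw [h2, he] at h2'
    rcases (AutomatonCode.mem_addCount_language _ _ _ _).1 hw' with hw' | hw'
    · exact huv _ h1' h2' ((hA w).1 hw')
    · rw [hcount, h1'] at hw'
      exact hw' hn

theorem mainTheorem11 : ¬ ComputablePred ShufflingProblem := by
  intro h
  -- A universal program: on input `n` it runs the `n`-th code on `0`. Hence a single automaton
  -- serves all instances, and the code to be tested enters only through the number to be counted.
  have hf : Partrec fun n : ℕ => Nat.Partrec.Code.eval (Denumerable.ofNat Nat.Partrec.Code n) 0 :=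
    Nat.Partrec.Code.eval_part.comp (Computable.ofNat _) (Computable.const 0)
  obtain ⟨c, hc⟩ := Turing.ToPartrec.Code.exists_code (Nat.Partrec'.part_iff₁.2 hf)
  obtain ⟨A, k, a, hA⟩ := exists_shufflingProblem_iff_dom c
  refine ComputablePred.halting_problem 0 (ComputablePred.computable_of_manyOneReducible
    ⟨fun c => (k, k, A.addCount k k a (Encodable.encode c)), ?_, fun c' => ?_⟩ h)
  · exact (Computable.const k).pair ((Computable.const k).pair
      ((A.computable_addCount k k a).comp Computable.encode))
  · have := hc (Encodable.encode c' ::ᵥ List.Vector.nil)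
    rw [hA]
    change _ ↔ (c.eval (Encodable.encode c' ::ᵥ List.Vector.nil).1).Dom
    rw [this]
    simp
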